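/- For an integer $d\ge 0$ let $\Sigma_d=\mathbb P(\mathcal O_{\mathbb P^1}\oplus\mathcal O_{\mathbb P^1}(d))$ be the complex Hirzebruch surface with its ruling $\Sigma_d\to\mathbb P^1$. A Danilov–Gizatullin surface $V_n$ is the complement $\Sigma_d\setminus S$ of an ample section $S$ of the ruling of some $\Sigma_d$ with self-intersection number $S\cdot S=n$. It is a smooth affine surface; let $\mathbb C[V_n]$ be its ring of regular functions. A $\mathbb C$-derivation $\delta$ of $\mathbb C[V_n]$ is locally nilpotent if for every $f\in\mathbb C[V_n]$ there is $k\ge 0$ with $\delta^k(f)=0$. Let $\mathrm{ML}(V_n)\subseteq\mathbb C[V_n]$ be the intersection of the kernels of all locally nilpotent derivations, and let $\mathrm D(V_n)\subseteq\mathbb C[V_n]$ be the $\mathbb C$-subalgebra generated by the kernels of all nonzero locally nilpotent derivations. **Theorem.** For every $n$ and every Danilov–Gizatullin surface $V_n$ (for every $d$ and every ample section $S$ of $\Sigma_d$ with $S\cdot S=n$), $$\mathrm D(V_n)=\mathbb C[V_n]\qquad\text{and}\qquad \mathrm{ML}(V_n)\cong\mathbb C .$$ -/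

import Mathlib

/-! ## Hirzebruch surfaces in homogeneous coordinates

`z = (s, t, u, v)` are the homogeneous coordinates on `Σ_d = ℙ(𝒪 ⊕ 𝒪(d))`: the surface is the quotient
of `(ℂ² ∖ 0) × (ℂ² ∖ 0)` by `(λ, μ) • (s, t, u, v) = (λ s, λ t, μ u, λ⁻ᵈ μ v)`. -/

/-- The points of `(ℂ² ∖ 0) × (ℂ² ∖ 0)`. -/
def InCone (z : Fin 4 → ℂ) : Prop :=
  ¬ (z 0 = 0 ∧ z 1 = 0) ∧ ¬ (z 2 = 0 ∧ z 3 = 0)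

/-- The action of the torus `(ℂˣ)²` on homogeneous coordinates. -/
noncomputable def torusAct (d : ℕ) (l m : ℂˣ) (z : Fin 4 → ℂ) : Fin 4 → ℂ :=
  ![(l : ℂ) * z 0, (l : ℂ) * z 1, (m : ℂ) * z 2, ((l⁻¹ ^ d * m : ℂˣ) : ℂ) * z 3]

/-- Two coordinate vectors are equivalent when they lie in the same torus orbit. -/
def hirzebruchSetoid (d : ℕ) : Setoid {z : Fin 4 → ℂ // InCone z} where
  r z z' := ∃ l m : ℂˣ, (z' : Fin 4 → ℂ) = torusAct d l m z
  iseqv := by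
    refine ⟨fun z => ⟨1, 1, ?_⟩, ?_, ?_⟩
    · ext i; fin_cases i <;> simp [torusAct]
    · rintro z z' ⟨l, m, h⟩
      refine ⟨l⁻¹, m⁻¹, ?_⟩
      rw [h]
      ext i; fin_cases i <;> simp [torusAct]
      field_simp
    · rintro z z' z'' ⟨l, m, h⟩ ⟨l', m', h'⟩
      refine ⟨l' * l, m' * m, ?_⟩
      rw [h', h]
      ext i
      fin_cases i <;> simp [torusAct] <;> ring

/-- The Hirzebruch surface `Σ_d` (its set of complex points). -/
def HirzebruchSurface (d : ℕ) : Type := Quotient (hirzebruchSetoid d)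

namespace HirzebruchSurface

/-- The point `[s : t ; u : v]` with the given homogeneous coordinates. -/
def mk (d : ℕ) (z : Fin 4 → ℂ) (hz : InCone z) : HirzebruchSurface d :=
  Quotient.mk (hirzebruchSetoid d) ⟨z, hz⟩

/-- The bidegrees of the coordinates `s, t, u, v`. -/
def weight (d : ℕ) : Fin 4 → ℤ × ℤ :=
  ![(1, 0), (1, 0), (0, 1), (-(d : ℤ), 1)]

/-- `G` is bihomogeneous of bidegree `c`. The class group of `Σ_d` is `ℤ²` through the bidegree, and the
bihomogeneous polynomials of bidegree `c` are the global sections of the line bundle `𝒪(c)`. -/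
abbrev IsBihomogeneous (d : ℕ) (G : MvPolynomial (Fin 4) ℂ) (c : ℤ × ℤ) : Prop :=
  MvPolynomial.IsWeightedHomogeneous (weight d) G c

/-- The zero locus in `Σ_d` of a (bihomogeneous) polynomial. -/
def zeroLocus (d : ℕ) (G : MvPolynomial (Fin 4) ℂ) : Set (HirzebruchSurface d) :=
  {x | ∀ (z : Fin 4 → ℂ) (hz : InCone z), mk d z hz = x → MvPolynomial.eval z G = 0}

lemma fst_ne_zero {z : Fin 4 → ℂ} (hz : InCone z) : (![z 0, z 1] : Fin 2 → ℂ) ≠ 0 := fun h =>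
  hz.1 ⟨by simpa using congrFun h 0, by simpa using congrFun h 1⟩

/-- The ruling `Σ_d → ℙ¹`, `[s : t ; u : v] ↦ [s : t]`. -/
noncomputable def ruling (d : ℕ) : HirzebruchSurface d → Projectivization ℂ (Fin 2 → ℂ) :=
  Quotient.lift (fun z : {z : Fin 4 → ℂ // InCone z} =>
      Projectivization.mk ℂ ![z.1 0, z.1 1] (fst_ne_zero z.2)) (by
    rintro ⟨z, hz⟩ ⟨z', hz'⟩ ⟨l, m, h⟩
    rw [Projectivization.mk_eq_mk_iff]
    refine ⟨l⁻¹, ?_⟩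
    have h' : z' = torusAct d l m z := h
    subst h'
    ext i
    fin_cases i <;> simp [torusAct, Units.smul_def])

/-- A map `ℙ¹ → Σ_d` is regular when it is given, locally in the Zariski topology of `ℙ¹`, by polynomials
in the homogeneous coordinates. -/
def IsRegularMap (d : ℕ) (f : Projectivization ℂ (Fin 2 → ℂ) → HirzebruchSurface d) : Prop :=
  ∀ p : Fin 2 → ℂ, p ≠ 0 →
    ∃ (e : ℕ) (h : MvPolynomial (Fin 2) ℂ) (A : Fin 4 → MvPolynomial (Fin 2) ℂ),
      h.IsHomogeneous e ∧ MvPolynomial.eval p h ≠ 0 ∧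
      ∀ (q : Fin 2 → ℂ) (hq : q ≠ 0), MvPolynomial.eval q h ≠ 0 →
        ∃ hA : InCone (fun i => MvPolynomial.eval q (A i)),
          f (Projectivization.mk ℂ q hq) = mk d (fun i => MvPolynomial.eval q (A i)) hA

/-- `S` is a section of the ruling: the image of a regular map `σ : ℙ¹ → Σ_d` that is a right inverse
of the ruling. -/
def IsSection (d : ℕ) (S : Set (HirzebruchSurface d)) : Prop :=
  ∃ σ : Projectivization ℂ (Fin 2 → ℂ) → HirzebruchSurface d,
    IsRegularMap d σ ∧ (∀ p, ruling d (σ p) = p) ∧ S = Set.range σ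

/-- `S` is a prime divisor of class `c`: the zero locus of an irreducible bihomogeneous polynomial
of bidegree `c`. -/
def HasClass (d : ℕ) (S : Set (HirzebruchSurface d)) (c : ℤ × ℤ) : Prop :=
  ∃ F : MvPolynomial (Fin 4) ℂ, Irreducible F ∧ IsBihomogeneous d F c ∧ S = zeroLocus d F

/-- The tangent space at `z` of the torus orbit of `z`; the tangent space of `Σ_d` at the point with
coordinates `z` is the quotient of `ℂ⁴` by it. -/
def orbitTangent (d : ℕ) (z : Fin 4 → ℂ) : Submodule ℂ (Fin 4 → ℂ) :=
  Submodule.span ℂ {![z 0, z 1, 0, -(d : ℂ) * z 3], ![0, 0, z 2, z 3]}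

/-- The line bundle `𝒪(c)` is very ample: its global sections separate points and tangent vectors,
that is, they define a closed embedding of `Σ_d` into a projective space. -/
def IsVeryAmple (d : ℕ) (c : ℤ × ℤ) : Prop :=
  (∀ (z z' : Fin 4 → ℂ) (hz : InCone z) (hz' : InCone z'), mk d z hz ≠ mk d z' hz' →
    ∃ G : MvPolynomial (Fin 4) ℂ, IsBihomogeneous d G c ∧
      MvPolynomial.eval z G = 0 ∧ MvPolynomial.eval z' G ≠ 0) ∧
  (∀ z : Fin 4 → ℂ, InCone z → ∀ w : Fin 4 → ℂ, w ∉ orbitTangent d z →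
    ∃ G : MvPolynomial (Fin 4) ℂ, IsBihomogeneous d G c ∧
      MvPolynomial.eval z G = 0 ∧ ∑ i, w i * MvPolynomial.eval z (MvPolynomial.pderiv i G) ≠ 0)

/-- A divisor class is ample when some positive multiple of it is very ample. -/
def IsAmple (d : ℕ) (c : ℤ × ℤ) : Prop :=
  ∃ k : ℕ, 0 < k ∧ IsVeryAmple d (k • c)

/-- The intersection form on the class group `ℤ²`: the fibre class `f = (1, 0)` and the class
`ξ = (0, 1)` of the curve `u = 0` satisfy `f · f = 0`, `f · ξ = 1`, `ξ · ξ = d`. -/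
def intersection (d : ℕ) (c c' : ℤ × ℤ) : ℤ :=
  c.1 * c'.2 + c.2 * c'.1 + d * (c.2 * c'.2)

/-- `V` is a Danilov–Gizatullin surface with invariant `n`, realised in `Σ_d`: the complement of an ample
section `S` with `S · S = n`. -/
def IsDanilovGizatullin (n d : ℕ) (V : Set (HirzebruchSurface d)) : Prop :=
  ∃ (S : Set (HirzebruchSurface d)) (c : ℤ × ℤ),
    IsSection d S ∧ HasClass d S c ∧ IsAmple d c ∧ intersection d c c = n ∧ V = Sᶜ

/-- A function on `V ⊆ Σ_d` is regular when it is, locally in the Zariski topology, a quotient of two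
bihomogeneous polynomials of the same bidegree. -/
def IsRegularFunction (d : ℕ) (V : Set (HirzebruchSurface d)) (f : V → ℂ) : Prop :=
  ∀ (z : Fin 4 → ℂ) (hz : InCone z), mk d z hz ∈ V →
    ∃ (c : ℤ × ℤ) (G H : MvPolynomial (Fin 4) ℂ),
      IsBihomogeneous d G c ∧ IsBihomogeneous d H c ∧ MvPolynomial.eval z H ≠ 0 ∧
      ∀ (y : Fin 4 → ℂ) (hy : InCone y) (hV : mk d y hy ∈ V), MvPolynomial.eval y H ≠ 0 →
        f ⟨mk d y hy, hV⟩ = MvPolynomial.eval y G / MvPolynomial.eval y H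

/-- The ring `ℂ[V]` of regular functions on `V`. -/
def coordinateRing (d : ℕ) (V : Set (HirzebruchSurface d)) : Subalgebra ℂ (V → ℂ) where
  carrier := {f | IsRegularFunction d V f}
  mul_mem' := by
    intro f g hf hg z hz hzV
    obtain ⟨c, G, H, hG, hH, h0, h⟩ := hf z hz hzV
    obtain ⟨c', G', H', hG', hH', h0', h'⟩ := hg z hz hzV
    refine ⟨c + c', G * G', H * H', hG.mul hG', hH.mul hH', by simp [h0, h0'], ?_⟩
    intro y hy hV hne
    rw [map_mul] at hne
    rw [Pi.mul_apply, h y hy hV (left_ne_zero_of_mul hne), h' y hy hV (right_ne_zero_of_mul hne),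
      map_mul, map_mul, div_mul_div_comm]
  add_mem' := by
    intro f g hf hg z hz hzV
    obtain ⟨c, G, H, hG, hH, h0, h⟩ := hf z hz hzV
    obtain ⟨c', G', H', hG', hH', h0', h'⟩ := hg z hz hzV
    refine ⟨c + c', G * H' + H * G', H * H', (hG.mul hH').add (hH.mul hG'), hH.mul hH',
      by simp [h0, h0'], ?_⟩
    intro y hy hV hne
    rw [map_mul] at hne
    have h1 := left_ne_zero_of_mul hne
    have h2 := right_ne_zero_of_mul hne
    rw [Pi.add_apply, h y hy hV h1, h' y hy hV h2, div_add_div _ _ h1 h2]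
    simp
  algebraMap_mem' := by
    intro a z hz hzV
    refine ⟨0, MvPolynomial.C a, 1, MvPolynomial.isWeightedHomogeneous_C _ _,
      MvPolynomial.isWeightedHomogeneous_one _ _, by simp, ?_⟩
    intro y hy hV _
    simp

end HirzebruchSurface

/-! ## Makar-Limanov and Derksen invariants -/

/-- A derivation is locally nilpotent when every element is killed by some power of it. -/
def IsLocallyNilpotent {A : Type*} [CommRing A] [Algebra ℂ A] (δ : Derivation ℂ A A) : Prop :=
  ∀ f : A, ∃ k : ℕ, (fun g : A => δ g)^[k] f = 0

/-- The Makar-Limanov invariant: the intersection of the kernels of all locally nilpotent derivations. -/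
def makarLimanovInvariant (A : Type*) [CommRing A] [Algebra ℂ A] : Subalgebra ℂ A where
  carrier := {f | ∀ δ : Derivation ℂ A A, IsLocallyNilpotent δ → δ f = 0}
  mul_mem' := by
    intro f g hf hg δ hδ
    rw [Derivation.leibniz, hf δ hδ, hg δ hδ, smul_zero, smul_zero, add_zero]
  add_mem' := by
    intro f g hf hg δ hδ
    rw [map_add, hf δ hδ, hg δ hδ, add_zero]
  algebraMap_mem' := fun a δ _ => δ.map_algebraMap a

/-- The Derksen invariant: the subalgebra generated by the kernels of all nonzero locally nilpotent
derivations. -/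
def derksenInvariant (A : Type*) [CommRing A] [Algebra ℂ A] : Subalgebra ℂ A :=
  Algebra.adjoin ℂ {f | ∃ δ : Derivation ℂ A A, IsLocallyNilpotent δ ∧ δ ≠ 0 ∧ δ f = 0}

/-! Everything takes place in the homogeneous coordinate ring ℂ[s, t, u, v]. The section S is F = 0
with F = A u + B v, where A and B are binary forms of degrees m + 1 and m + d + 1 without common
zero; ampleness makes the first degree positive. By the Nullstellensatz (`exists_isFraction`) every
regular function on V is G / F ^ k with G of bidegree k (m + 1, 1). Restricting G to S ≅ ℙ¹ along
(s, t) ↦ (s, t, -B, A) gives a binary form of degree k N, where N = 2 m + d + 2 = S · S. If it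
vanishes, F divides G and the pole order k can be lowered
(`exists_isFraction_of_restrictToSection_eq_zero`). Both equalities follow by induction on k,
starting from the constants at k = 0.

Locally nilpotent derivations come in a family indexed by p ∈ ℂ. Put ℓ = X₁ - p X₀. Bézout for
binary forms gives γ, δ of degrees m and m + d with Δ = A δ - B γ = ℓ ^ (N - 1). With F' = γ u + δ
v, let E be the derivation that kills F and F' and is Δ (∂₀ + p ∂₁) on ℂ[s, t]. It is locally
nilpotent, and F' ^ (N - 2) E has the right bidegree to descend to V
(`exists_locallyNilpotent_derivation`). Its kernel contains ℓ F' / F, whose numerator restricts to ℓ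
^ N on S, and every numerator of a kernel element restricts to a form killed by ∂₀ + p ∂₁.

Derksen invariant: the powers ℓ ^ (k N), as p varies, span the binary forms of degree k N, so any
leading term along S is matched by kernel elements. Makar-Limanov invariant: the restriction of an
element of all kernels has zero gradient, hence vanishes when k > 0 by Euler's identity. -/

open MvPolynomial HirzebruchSurface

/-! ## Binary forms -/

namespace Polynomial

/-- In a Bézout solution the coefficient of β can be reduced modulo α; comparing degrees in the
equation then bounds the coefficient of α. -/
lemma exists_mul_add_mul_eq_of_natDegree_eq {K : Type*} [Field K] {α β τ : K[X]} {i j : ℕ}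
    (h : IsCoprime α β) (hα : α.natDegree = i + 1) (hβ : β.natDegree ≤ j + 1)
    (hτ : τ.natDegree ≤ i + j + 1) :
    ∃ δ γ : K[X], δ.natDegree ≤ j ∧ γ.natDegree ≤ i ∧ α * δ + β * γ = τ := by
  obtain ⟨x, y, hxy⟩ := h
  have hα0 : α ≠ 0 := by rintro rfl; simp at hα
  have hr : (τ * y % α).natDegree ≤ i := by
    have := natDegree_mod_lt (τ * y) (q := α) (by omega)
    omega
  have heq : α * (τ * x + β * (τ * y / α)) + β * (τ * y % α) = τ := by
    have := EuclideanDomain.div_add_mod (τ * y) α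
    linear_combination τ * hxy + β * this
  refine ⟨_, _, ?_, hr, heq⟩
  set δ := τ * x + β * (τ * y / α)
  by_cases hδ : δ = 0
  · simp [hδ]
  have h1 : (α * δ).natDegree ≤ i + j + 1 := by
    rw [eq_sub_of_add_eq heq]
    refine (natDegree_sub_le _ _).trans (max_le hτ (natDegree_mul_le.trans ?_))
    omega
  rw [natDegree_mul hα0 hδ] at h1
  omega

end Polynomial

/-- The derivation `∂₀ + p ∂₁` of `ℂ[X₀, X₁]`, which kills the linear form `X₁ - p X₀`. -/
noncomputable def slopeDerivation (p : ℂ) :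
    Derivation ℂ (MvPolynomial (Fin 2) ℂ) (MvPolynomial (Fin 2) ℂ) :=
  pderiv 0 + p • pderiv 1

/-- The linear form `X₁ - p X₀`. -/
noncomputable def slopeForm (p : ℂ) : MvPolynomial (Fin 2) ℂ := X 1 - C p * X 0

lemma slopeDerivation_slopeForm (p q : ℂ) :
    slopeDerivation p (slopeForm q) = C (p - q) := by
  simp [slopeDerivation, slopeForm, pderiv_X, smul_eq_C_mul]
  ring

lemma slopeForm_isHomogeneous (p : ℂ) : (slopeForm p).IsHomogeneous 1 :=
  (isHomogeneous_X _ _).sub ((isHomogeneous_X _ _).C_mul _)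

lemma slopeForm_ne_zero (p : ℂ) : slopeForm p ≠ 0 := fun h => by
  simpa [slopeForm] using congrArg (eval ![0, 1]) h

lemma slopeDerivation_isHomogeneous (p : ℂ) {φ : MvPolynomial (Fin 2) ℂ} {n : ℕ}
    (h : φ.IsHomogeneous (n + 1)) : (slopeDerivation p φ).IsHomogeneous n := by
  have h0 := h.pderiv (i := 0)
  have h1 := h.pderiv (i := 1)
  simp only [Nat.add_sub_cancel] at h0 h1
  simp only [slopeDerivation, Derivation.add_apply, Derivation.smul_apply, smul_eq_C_mul]
  exact h0.add (h1.C_mul _)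

lemma exists_homogenize_eq {A : MvPolynomial (Fin 2) ℂ} {n : ℕ} (hA : A.IsHomogeneous n) :
    ∃ α : Polynomial ℂ, α.natDegree ≤ n ∧ α.homogenize n = A := by
  refine ⟨aeval ![Polynomial.X, 1] A, ?_, Polynomial.homogenize_eq_of_isHomogeneous hA rfl⟩
  rw [A.as_sum, map_sum]
  refine Polynomial.natDegree_sum_le_of_forall_le _ _ fun e he => ?_
  have hdeg : e 0 + e 1 = n := by
    have := hA (mem_support_iff.1 he)
    simpa [Finsupp.weight_apply, Finsupp.sum_fintype] using this
  rw [aeval_monomial, Finsupp.prod_fintype _ _ (by simp), Fin.prod_univ_two]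
  simp only [Matrix.cons_val_zero, Matrix.cons_val_one, one_pow, mul_one,
    Polynomial.algebraMap_apply, Algebra.algebraMap_self, RingHom.id_apply]
  exact (Polynomial.natDegree_C_mul_X_pow_le _ _).trans (by omega)

/-- Two binary forms without common zero generate all forms of sufficiently large degree. -/
lemma exists_bezout_forms {A B τ : MvPolynomial (Fin 2) ℂ} {i j : ℕ}
    (hA : A.IsHomogeneous (i + 1)) (hB : B.IsHomogeneous (j + 1))
    (hτ : τ.IsHomogeneous (i + j + 1))
    (h : ∀ q : Fin 2 → ℂ, q ≠ 0 → eval q A = 0 → eval q B ≠ 0) :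
    ∃ γ δ : MvPolynomial (Fin 2) ℂ, γ.IsHomogeneous i ∧ δ.IsHomogeneous j ∧
      A * δ - B * γ = τ := by
  obtain ⟨α, hα, rfl⟩ : ∃ α : Polynomial ℂ, α.natDegree ≤ i + 1 ∧ α.homogenize (i + 1) = A :=
    exists_homogenize_eq hA
  obtain ⟨β, hβ, rfl⟩ : ∃ α : Polynomial ℂ, α.natDegree ≤ j + 1 ∧ α.homogenize (j + 1) = B :=
    exists_homogenize_eq hB
  obtain ⟨τ, ht, rfl⟩ : ∃ α : Polynomial ℂ, α.natDegree ≤ i + j + 1 ∧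
    α.homogenize (i + j + 1) = τ := exists_homogenize_eq hτ
  have hco : IsCoprime α β := by
    rw [Polynomial.isCoprime_iff_aeval_ne_zero_of_isAlgClosed ℂ ℂ]
    intro x
    by_contra! hx
    refine h ![x, 1] (fun h => by simpa using congrFun h 1) ?_ ?_
    · rw [Polynomial.eval_homogenize hα _ (by simp)]; simpa using hx.1
    · rw [Polynomial.eval_homogenize hβ _ (by simp)]; simpa using hx.2
  have key : ∃ γ δ : Polynomial ℂ, γ.natDegree ≤ i ∧ δ.natDegree ≤ j ∧ α * δ - β * γ = τ := by
    by_cases h1 : α.natDegree = i + 1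
    · obtain ⟨δ, γ, hδ, hγ, e⟩ :=
        Polynomial.exists_mul_add_mul_eq_of_natDegree_eq hco h1 hβ ht
      exact ⟨-γ, δ, by simpa using hγ, hδ, by rw [← e]; ring⟩
    by_cases h2 : β.natDegree = j + 1
    · obtain ⟨δ, γ, hδ, hγ, e⟩ :=
        Polynomial.exists_mul_add_mul_eq_of_natDegree_eq hco.symm h2 hα
        (ht.trans (by omega))
      exact ⟨-δ, γ, by simpa using hδ, hγ, by rw [← e]; ring⟩
    -- If both dehomogenized polynomials drop in degree, both forms vanish at the point at infinity
    -- [1 : 0].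
    exfalso
    have aux : ∀ (r : Polynomial ℂ) (k : ℕ), r.natDegree < k →
        eval ![1, 0] (r.homogenize k) = 0 := by
      intro r k hr
      rw [Polynomial.homogenize, map_sum]
      refine Finset.sum_eq_zero fun kl hkl => ?_
      rw [Finset.HasAntidiagonal.mem_antidiagonal] at hkl
      rw [eval_monomial, Finsupp.prod_fintype _ _ (by simp), Fin.prod_univ_two]
      by_cases h0 : kl.2 = 0
      · rw [Polynomial.coeff_eq_zero_of_natDegree_lt (by omega), zero_mul]
      · simp [h0]
    exact h ![1, 0] (fun h => by simpa using congrFun h 0) (aux _ _ (by omega)) (aux _ _ (by omega))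
  obtain ⟨γ, δ, hγ, hδ, rfl⟩ := key
  refine ⟨γ.homogenize i, δ.homogenize j, Polynomial.isHomogeneous_homogenize _,
    Polynomial.isHomogeneous_homogenize _, ?_⟩
  rw [Polynomial.homogenize_sub, ← Polynomial.homogenize_mul _ _ hα hδ,
    ← Polynomial.homogenize_mul _ _ hβ hγ]
  congr 2 <;> omega

/-- Apply a linear functional to (X₁ - p X₀) ^ n: the result is a polynomial in p whose coefficients
are the values on the monomials of degree n times nonzero binomial factors. If it vanishes for all
p, the functional kills every form of degree n. -/
lemma mem_span_slopeForm_pow {φ : MvPolynomial (Fin 2) ℂ} {n : ℕ} (h : φ.IsHomogeneous n) :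
    φ ∈ Submodule.span ℂ (Set.range fun p : ℂ => slopeForm p ^ n) := by
  by_contra hφ
  obtain ⟨f, hf, hle⟩ := Submodule.exists_le_ker_of_notMem hφ
  have h0 : ∀ p : ℂ, f (slopeForm p ^ n) = 0 := fun p =>
    hle (Submodule.subset_span ⟨p, rfl⟩)
  have h1 : ∀ i ∈ Finset.range (n + 1), f (X 0 ^ i * X 1 ^ (n - i)) = 0 := by
    let r : Polynomial ℂ := ∑ i ∈ Finset.range (n + 1),
      Polynomial.C ((-1) ^ i * n.choose i * f (X 0 ^ i * X 1 ^ (n - i))) * Polynomial.X ^ i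
    have hr : r = 0 := by
      refine Polynomial.funext fun p => ?_
      rw [Polynomial.eval_zero, ← h0 p, slopeForm, sub_eq_neg_add, add_pow, map_sum]
      simp only [r, Polynomial.eval_finsetSum, Polynomial.eval_mul, Polynomial.eval_C,
        Polynomial.eval_pow, Polynomial.eval_X]
      refine Finset.sum_congr rfl fun i _ => ?_
      have : (-(C p * X 0)) ^ i * X 1 ^ (n - i) * (n.choose i : MvPolynomial (Fin 2) ℂ) =
          ((-1) ^ i * n.choose i * p ^ i) • (X 0 ^ i * X 1 ^ (n - i)) := by
        rw [smul_eq_C_mul]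
        simp only [map_mul, map_pow, map_neg, map_one, map_natCast]
        ring
      rw [this, map_smul, smul_eq_mul]
      ring
    intro i hi
    have := congrArg (fun q => Polynomial.coeff q i) hr
    simp only [r, Polynomial.finsetSum_coeff, Polynomial.coeff_C_mul_X_pow] at this
    rw [Finset.sum_ite_eq] at this
    rw [if_pos hi] at this
    have hc : (n.choose i : ℂ) ≠ 0 := by
      exact_mod_cast (Nat.choose_pos (by simpa [Nat.lt_succ_iff] using hi)).ne'
    simpa [hc] using this
  refine hf ?_
  rw [φ.as_sum, map_sum]
  refine Finset.sum_eq_zero fun e he => ?_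
  have hdeg : e 0 + e 1 = n := by
    have := h (mem_support_iff.1 he)
    simpa [Finsupp.weight_apply, Finsupp.sum_fintype] using this
  have : monomial e (coeff e φ) = coeff e φ • (X 0 ^ e 0 * X 1 ^ (n - e 0)) := by
    rw [monomial_eq, smul_eq_C_mul, Finsupp.prod_fintype _ _ (by simp), Fin.prod_univ_two]
    congr 3
    omega
  rw [this, map_smul, h1 _ (by simp; omega), smul_zero]

/-! ## Bihomogeneous polynomials -/

namespace HirzebruchSurface

lemma weight_eq (d : ℕ) (e : Fin 4 →₀ ℕ) :
    Finsupp.weight (weight d) e = ((e 0 : ℤ) + e 1 - d * e 3, (e 2 : ℤ) + e 3) := by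
  rw [Finsupp.weight_apply, Finsupp.sum_fintype _ _ (by simp), Fin.sum_univ_four]
  ext
  · simp [weight]; ring
  · simp [weight]

lemma isBihomogeneous_X (d : ℕ) (i : Fin 4) : IsBihomogeneous d (X i) (weight d i) :=
  isWeightedHomogeneous_X _ _ _

lemma isBihomogeneous_congr {d : ℕ} {G : MvPolynomial (Fin 4) ℂ} {c c' : ℤ × ℤ}
    (h : IsBihomogeneous d G c) (e : c = c') : IsBihomogeneous d G c' := e ▸ h

/-- The weight of v has a nonpositive first entry, so the second entry must be used first: it
excludes u and v, after which the first excludes s and t. This is the case of pole order zero. -/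
lemma exists_eq_C_of_isBihomogeneous_zero {d : ℕ} {G : MvPolynomial (Fin 4) ℂ}
    (h : IsBihomogeneous d G 0) : ∃ r : ℂ, G = C r := by
  refine ⟨coeff 0 G, ?_⟩
  ext e
  rw [coeff_C]
  split_ifs with he
  · rw [he]
  · by_contra hne
    have := h hne
    rw [weight_eq, Prod.ext_iff] at this
    simp only [Prod.fst_zero, Prod.snd_zero] at this
    have h2 : e 2 = 0 := by omega
    have h3 : e 3 = 0 := by omega
    rw [h3] at this
    apply he
    ext i
    fin_cases i <;> simp <;> omega

lemma eval_torusAct {d : ℕ} {G : MvPolynomial (Fin 4) ℂ} {c : ℤ × ℤ} (h : IsBihomogeneous d G c)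
    (l m : ℂˣ) (z : Fin 4 → ℂ) :
    eval (torusAct d l m z) G = ((l ^ c.1 * m ^ c.2 : ℂˣ) : ℂ) * eval z G := by
  rw [eval_eq', eval_eq', Finset.mul_sum]
  refine Finset.sum_congr rfl fun e he => ?_
  have hw := h (mem_support_iff.1 he)
  rw [weight_eq] at hw
  subst hw
  simp only [Fin.prod_univ_four, torusAct, Matrix.cons_val]
  push_cast
  rw [zpow_sub₀ l.ne_zero, zpow_add₀ l.ne_zero, zpow_add₀ m.ne_zero, zpow_mul]
  simp only [zpow_natCast, mul_pow, inv_pow]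
  field_simp

lemma weightedHomogeneousComponent_mul_of_left {σ M R : Type*} [CommSemiring R]
    [AddCancelCommMonoid M] {w : σ → M} {F : MvPolynomial σ R} {c : M}
    (hF : IsWeightedHomogeneous w F c) (H : MvPolynomial σ R) (c' : M) :
    weightedHomogeneousComponent w (c + c') (F * H) =
      F * weightedHomogeneousComponent w c' H := by
  classical
  let _ := weightedGradedAlgebra R w
  have := DirectSum.coe_decompose_mul_add_of_left_mem (weightedHomogeneousSubmodule R w)
    (j := c') (b := H) hF
  rwa [show DirectSum.decompose (weightedHomogeneousSubmodule R w) (F * H) =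
      (weightedDecomposition R w).decompose' (F * H) from rfl,
    show DirectSum.decompose (weightedHomogeneousSubmodule R w) H =
      (weightedDecomposition R w).decompose' H from rfl,
    weightedDecomposition.decompose'_apply, weightedDecomposition.decompose'_apply] at this

/-- Removing a homogeneous factor keeps bihomogeneity. -/
lemma exists_isBihomogeneous_of_dvd {d : ℕ} {F G : MvPolynomial (Fin 4) ℂ} {c c' : ℤ × ℤ}
    (hF : IsBihomogeneous d F c) (hG : IsBihomogeneous d G (c + c')) (h : F ∣ G) :
    ∃ H, IsBihomogeneous d H c' ∧ G = F * H := by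
  obtain ⟨H, rfl⟩ := h
  refine ⟨weightedHomogeneousComponent (weight d) c' H,
    weightedHomogeneousComponent_isWeightedHomogeneous _ _, ?_⟩
  rw [← weightedHomogeneousComponent_mul_of_left hF, hG.weightedHomogeneousComponent_same]

end HirzebruchSurface

/-! ### Forms linear on the fibres and restriction to the section -/

/-- The inclusion `ℂ[s, t] ⊆ ℂ[s, t, u, v]`. -/
noncomputable def ofBase : MvPolynomial (Fin 2) ℂ →ₐ[ℂ] MvPolynomial (Fin 4) ℂ :=
  rename ![0, 1]

lemma ofBase_isBihomogeneous (d : ℕ) {φ : MvPolynomial (Fin 2) ℂ} {n : ℕ}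
    (h : φ.IsHomogeneous n) : IsBihomogeneous d (ofBase φ) (n, 0) := by
  rw [φ.as_sum, map_sum]
  refine IsWeightedHomogeneous.sum _ _ _ fun e he => ?_
  have hdeg : e 0 + e 1 = n := by
    have := h (mem_support_iff.1 he)
    simpa [Finsupp.weight_apply, Finsupp.sum_fintype] using this
  rw [monomial_eq, Finsupp.prod_fintype _ _ (by simp), Fin.prod_univ_two]
  simp only [map_mul, map_pow, ofBase, rename_C, rename_X, Matrix.cons_val_zero,
    Matrix.cons_val_one]
  refine isBihomogeneous_congr
    ((((isBihomogeneous_X d 0).pow _).mul ((isBihomogeneous_X d 1).pow _)).C_mul _) ?_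
  ext <;> simp [weight, ← hdeg]

lemma eval_ofBase (z : Fin 4 → ℂ) (φ : MvPolynomial (Fin 2) ℂ) :
    eval z (ofBase φ) = eval ![z 0, z 1] φ := by
  rw [ofBase, eval_rename]
  congr 2
  ext i; fin_cases i <;> rfl

lemma ofBase_injective : Function.Injective ofBase :=
  rename_injective _ (by decide)

/-- The form `A u + B v`. -/
noncomputable def sectionForm (A B : MvPolynomial (Fin 2) ℂ) : MvPolynomial (Fin 4) ℂ :=
  ofBase A * X 2 + ofBase B * X 3

lemma sectionForm_isBihomogeneous {d : ℕ} {i j : ℤ} {A B : MvPolynomial (Fin 2) ℂ}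
    (hA : IsBihomogeneous d (ofBase A) (i, 0)) (hB : IsBihomogeneous d (ofBase B) (j, 0))
    (hj : j = i + d) : IsBihomogeneous d (sectionForm A B) (i, 1) := by
  refine IsWeightedHomogeneous.add ?_ ?_
  · refine isBihomogeneous_congr (hA.mul (isBihomogeneous_X d 2)) ?_
    ext <;> simp [weight]
  · refine isBihomogeneous_congr (hB.mul (isBihomogeneous_X d 3)) ?_
    ext <;> simp [weight, hj]

/-- Restriction to the curve `A u + B v = 0`, parametrized by `(s, t) ↦ (s, t, -B, A)`. -/
noncomputable def restrictToSection (A B : MvPolynomial (Fin 2) ℂ) :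
    MvPolynomial (Fin 4) ℂ →ₐ[ℂ] MvPolynomial (Fin 2) ℂ :=
  aeval ![X 0, X 1, -B, A]

section restrict

variable (A B : MvPolynomial (Fin 2) ℂ)

lemma restrictToSection_ofBase (φ : MvPolynomial (Fin 2) ℂ) :
    restrictToSection A B (ofBase φ) = φ := by
  rw [restrictToSection, ofBase, aeval_rename]
  conv_rhs => rw [← aeval_X_left_apply φ]
  congr 2
  ext i; fin_cases i <;> rfl

lemma restrictToSection_sectionForm (γ δ : MvPolynomial (Fin 2) ℂ) :
    restrictToSection A B (sectionForm γ δ) = A * δ - B * γ := by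
  rw [sectionForm, map_add, map_mul, map_mul, restrictToSection_ofBase, restrictToSection_ofBase]
  simp [restrictToSection]
  ring

variable {A B}

/-- This is the degree of 𝒪(k S) on S, namely k times S · S = 2 (m + 1) + d. -/
lemma restrictToSection_isHomogeneous {m d k : ℕ} (hA : A.IsHomogeneous (m + 1))
    (hB : B.IsHomogeneous (m + d + 1)) {G : MvPolynomial (Fin 4) ℂ}
    (hG : IsBihomogeneous d G (k • (((m + 1 : ℕ) : ℤ), (1 : ℤ)))) :
    (restrictToSection A B G).IsHomogeneous (k * (2 * m + d + 2)) := by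
  rw [G.as_sum, map_sum]
  refine IsHomogeneous.sum _ _ _ fun e he => ?_
  have hw := hG (mem_support_iff.1 he)
  rw [weight_eq, Prod.ext_iff] at hw
  simp only [Prod.smul_mk] at hw
  simp only [nsmul_eq_mul, mul_one, Nat.cast_add, Nat.cast_one] at hw
  rw [restrictToSection, aeval_monomial, Finsupp.prod_fintype _ _ (by simp), Fin.prod_univ_four]
  simp only [Matrix.cons_val, algebraMap_eq]
  refine IsHomogeneous.C_mul ?_ _
  convert! ((((isHomogeneous_X ℂ (0 : Fin 2)).pow (e 0)).mul
    ((isHomogeneous_X ℂ (1 : Fin 2)).pow (e 1))).mul (hB.neg.pow (e 2))).mul (hA.pow (e 3)) using 1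
  obtain ⟨h1, h2⟩ := hw
  zify
  have h3 : (e 3 : ℤ) = k - e 2 := by omega
  rw [h3] at h1 ⊢
  linear_combination -h1

/-- Modulo F = A u + B v one may replace A u by -B v, so A ^ k G is congruent to v ^ k times the
restriction of G, where k is the degree of G in (u, v). It remains to cancel A ^ k, since the prime
F does not divide A. -/
lemma sectionForm_dvd_of_restrictToSection_eq_zero (hF : Prime (sectionForm A B)) (hA : A ≠ 0)
    (c : ℤ × ℤ) {d : ℕ} {G : MvPolynomial (Fin 4) ℂ} (hG : IsBihomogeneous d G c)
    (h : restrictToSection A B G = 0) : sectionForm A B ∣ G := by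
  by_cases hG0 : G = 0
  · simp [hG0]
  obtain ⟨e, he⟩ := ne_zero_iff.1 hG0
  have hc2 : 0 ≤ c.2 := by
    have := hG he
    rw [weight_eq, Prod.ext_iff] at this
    simp only at this
    omega
  obtain ⟨k, hk⟩ := Int.eq_ofNat_of_zero_le hc2
  have key : ∀ G : MvPolynomial (Fin 4) ℂ, IsBihomogeneous d G c →
      sectionForm A B ∣ ofBase A ^ k * G - X 3 ^ k * ofBase (restrictToSection A B G) := by
    intro G hG
    induction hG using IsWeightedHomogeneous.induction_on with
    | zero => simp
    | add p q hp hq ih1 ih2 =>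
      convert! ih1.add ih2 using 1
      simp only [map_add]; ring
    | monomial e r hw =>
      rw [weight_eq, Prod.ext_iff] at hw
      simp only at hw
      have hk : k = e 2 + e 3 := by omega
      have h1 := sub_dvd_pow_sub_pow (ofBase A * X 2) (-(ofBase B * X 3)) (e 2)
      rw [sub_neg_eq_add] at h1
      convert! h1.mul_left (C r * X 0 ^ e 0 * X 1 ^ e 1 * (ofBase A * X 3) ^ e 3) using 1
      have h2 : ofBase (X 0) = X 0 := rename_X _ _
      have h3 : ofBase (X 1) = X 1 := rename_X _ _
      have h4 : ofBase (C r) = C r := rename_C _ _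
      rw [restrictToSection, aeval_monomial, Finsupp.prod_fintype _ _ (by simp),
        Fin.prod_univ_four, monomial_eq, Finsupp.prod_fintype _ _ (by simp), Fin.prod_univ_four]
      simp only [Matrix.cons_val, algebraMap_eq, map_mul, map_pow, map_neg, h2, h3, h4, hk]
      rw [neg_pow (ofBase B * X 3), neg_pow (ofBase B)]
      ring
  have h1 := key G hG
  rw [h, map_zero, mul_zero, sub_zero] at h1
  refine (hF.dvd_or_dvd h1).resolve_left fun h2 => ?_
  have h3 := hF.dvd_of_dvd_pow h2
  obtain ⟨H, hH⟩ := h3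
  -- F restricts to 0 on its own zero curve while A restricts to itself, so F ∣ A would force A = 0.
  refine hA ?_
  have h4 := congrArg (restrictToSection A B) hH
  rw [map_mul, restrictToSection_sectionForm, restrictToSection_ofBase] at h4
  rw [h4]; ring

end restrict

/-! ## Locally nilpotent derivations of `ℂ[s, t, u, v]` -/

/-- The bound k + l is one more than needed for positive k and l, but it also covers k = 0 or l = 0,
where a factor is zero. -/
lemma Derivation.iterate_mul_eq_zero {R A : Type*} [CommRing R] [CommRing A] [Algebra R A]
    (D : Derivation R A A) (n : ℕ) : ∀ (k l : ℕ) (x y : A), n = k + l →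
      D^[k] x = 0 → D^[l] y = 0 → D^[n] (x * y) = 0 := by
  induction n with
  | zero =>
    intro k l x y h hx hy
    obtain rfl : k = 0 := by omega
    rw [Function.iterate_zero_apply] at hx
    rw [hx, zero_mul, iterate_map_zero]
  | succ n ih =>
    intro k l x y h hx hy
    rcases k with _ | k
    · simp_all [iterate_map_zero]
    rcases l with _ | l
    · simp_all [iterate_map_zero]
    rw [Function.iterate_succ_apply, D.leibniz, iterate_map_add, smul_eq_mul, smul_eq_mul,
      ih (k + 1) l x (D y) (by omega) hx hy, ih (l + 1) k y (D x) (by omega) hy hx, add_zero]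

/-- The subalgebra of elements killed by some power of a derivation. -/
def Derivation.nilpotentSubalgebra {R A : Type*} [CommRing R] [CommRing A] [Algebra R A]
    (D : Derivation R A A) : Subalgebra R A where
  carrier := {x | ∃ k, D^[k] x = 0}
  mul_mem' := by
    rintro x y ⟨k, hx⟩ ⟨l, hy⟩
    exact ⟨k + l, D.iterate_mul_eq_zero _ k l x y rfl hx hy⟩
  add_mem' := by
    rintro x y ⟨k, hx⟩ ⟨l, hy⟩
    refine ⟨k + l, ?_⟩
    rw [iterate_map_add, add_comm k l, Function.iterate_add_apply, hx, add_comm l k,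
      Function.iterate_add_apply, hy, iterate_map_zero, iterate_map_zero, add_zero]
  algebraMap_mem' r := ⟨1, D.map_algebraMap r⟩

lemma Derivation.iterate_mul_of_eq_zero {R A : Type*} [CommRing R] [CommRing A] [Algebra R A]
    (D : Derivation R A A) {x : A} (hx : D x = 0) (k : ℕ) (y : A) :
    D^[k] (x * y) = x * D^[k] y := by
  induction k generalizing y with
  | zero => rfl
  | succ k ih =>
    rw [Function.iterate_succ_apply, Function.iterate_succ_apply, D.leibniz, hx, smul_zero,
      add_zero, smul_eq_mul, ih]

/-- The derivation of `ℂ[s, t, u, v]` that extends a multiple of `∂₀ + p ∂₁` and kills the forms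
`A u + B v` and `γ u + δ v`. -/
noncomputable def sectionDerivation (p : ℂ) (A B γ δ : MvPolynomial (Fin 2) ℂ) :
    Derivation ℂ (MvPolynomial (Fin 4) ℂ) (MvPolynomial (Fin 4) ℂ) :=
  mkDerivation ℂ ![ofBase (A * δ - B * γ), C p * ofBase (A * δ - B * γ),
    ofBase B * sectionForm (slopeDerivation p γ) (slopeDerivation p δ) -
      ofBase δ * sectionForm (slopeDerivation p A) (slopeDerivation p B),
    ofBase γ * sectionForm (slopeDerivation p A) (slopeDerivation p B) -
      ofBase A * sectionForm (slopeDerivation p γ) (slopeDerivation p δ)]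

section

variable (p : ℂ) (A B γ δ : MvPolynomial (Fin 2) ℂ)

lemma slopeDerivation_X_zero : slopeDerivation p (X 0) = 1 := by
  simp [slopeDerivation, pderiv_X]

lemma slopeDerivation_X_one : slopeDerivation p (X 1) = C p := by
  simp [slopeDerivation, pderiv_X, smul_eq_C_mul]

lemma ofBase_X_zero : ofBase (X 0) = X 0 := rename_X _ _

lemma ofBase_X_one : ofBase (X 1) = X 1 := rename_X _ _

lemma ofBase_C (r : ℂ) : ofBase (C r) = C r := rename_C _ _

lemma sectionDerivation_ofBase (φ : MvPolynomial (Fin 2) ℂ) :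
    sectionDerivation p A B γ δ (ofBase φ) =
      ofBase (A * δ - B * γ) * ofBase (slopeDerivation p φ) := by
  induction φ using MvPolynomial.induction_on with
  | C r =>
    rw [ofBase_C, derivation_C, derivation_C, map_zero, mul_zero]
  | add f g hf hg => simp only [map_add, hf, hg, mul_add]
  | mul_X f i hf =>
    rw [map_mul, Derivation.leibniz, Derivation.leibniz, hf]
    fin_cases i
    · simp only [Fin.zero_eta, ofBase_X_zero, slopeDerivation_X_zero, sectionDerivation,
        mkDerivation_X, Matrix.cons_val, smul_eq_mul, map_add, map_mul, map_one]
      ring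
    · simp only [Fin.mk_one, ofBase_X_one, slopeDerivation_X_one, sectionDerivation,
        mkDerivation_X, Matrix.cons_val, smul_eq_mul, map_add, map_mul, ofBase_C]
      ring

/-- The values on u and v are Cramer's solution of the linear system saying that both forms are
killed; its determinant is A δ - B γ, and the same factor in the values on s and t clears the
denominator. -/
lemma sectionDerivation_sectionForm_left :
    sectionDerivation p A B γ δ (sectionForm A B) = 0 := by
  conv_lhs => rw [sectionForm, map_add, Derivation.leibniz, Derivation.leibniz,
    sectionDerivation_ofBase, sectionDerivation_ofBase]
  simp only [sectionDerivation, mkDerivation_X, Matrix.cons_val, sectionForm, smul_eq_mul,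
    map_sub, map_mul]
  ring

lemma sectionDerivation_sectionForm_right :
    sectionDerivation p A B γ δ (sectionForm γ δ) = 0 := by
  conv_lhs => rw [sectionForm, map_add, Derivation.leibniz, Derivation.leibniz,
    sectionDerivation_ofBase, sectionDerivation_ofBase]
  simp only [sectionDerivation, mkDerivation_X, Matrix.cons_val, sectionForm, smul_eq_mul,
    map_sub, map_mul]
  ring

variable {p A B γ δ}

/-- The derivation kills A u + B v, so it is tangent to the curve. The condition on Δ = A δ - B γ
makes it agree with the lift (s, t, -B, A) itself and not only up to rescaling (u, v): γ u + δ v is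
killed and restricts to Δ. -/
lemma restrictToSection_sectionDerivation (h : slopeDerivation p (A * δ - B * γ) = 0)
    (G : MvPolynomial (Fin 4) ℂ) :
    restrictToSection A B (sectionDerivation p A B γ δ G) =
      (A * δ - B * γ) * slopeDerivation p (restrictToSection A B G) := by
  induction G using MvPolynomial.induction_on with
  | C r =>
    rw [derivation_C, map_zero, ← ofBase_C, restrictToSection_ofBase, derivation_C, mul_zero]
  | add f g hf hg => simp only [map_add, hf, hg, mul_add]
  | mul_X f i hf =>
    suffices hX : restrictToSection A B (sectionDerivation p A B γ δ (X i)) =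
        (A * δ - B * γ) * slopeDerivation p (restrictToSection A B (X i)) by
      rw [map_mul (restrictToSection A B), Derivation.leibniz, Derivation.leibniz, map_add,
        smul_eq_mul, smul_eq_mul, map_mul, map_mul, hf, hX, smul_eq_mul, smul_eq_mul]
      ring
    simp only [map_sub, Derivation.leibniz, smul_eq_mul] at h
    fin_cases i
    · simp only [Fin.zero_eta, ← ofBase_X_zero, sectionDerivation_ofBase, map_mul,
        restrictToSection_ofBase]
    · simp only [Fin.mk_one, ← ofBase_X_one, sectionDerivation_ofBase, map_mul,
        restrictToSection_ofBase]
    · have : restrictToSection A B (X 2) = -B := by simp [restrictToSection]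
      simp only [Fin.reduceFinMk, this, map_neg]
      simp only [sectionDerivation, mkDerivation_X, Matrix.cons_val, map_sub, map_mul,
        restrictToSection_ofBase, restrictToSection_sectionForm]
      linear_combination B * h
    · have : restrictToSection A B (X 3) = A := by simp [restrictToSection]
      simp only [Fin.reduceFinMk, this]
      simp only [sectionDerivation, mkDerivation_X, Matrix.cons_val, map_sub, map_mul,
        restrictToSection_ofBase, restrictToSection_sectionForm]
      linear_combination (-A) * h

/-- The values on s and t are constant multiples of Δ, which is killed, so the second iterate kills
s and t. The multiples Δ u and Δ v are combinations of the two killed forms over ℂ[s, t]. -/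
lemma exists_iterate_sectionDerivation_eq_zero (h0 : A * δ - B * γ ≠ 0)
    (h : slopeDerivation p (A * δ - B * γ) = 0) (G : MvPolynomial (Fin 4) ℂ) :
    ∃ k, (sectionDerivation p A B γ δ)^[k] G = 0 := by
  set E := sectionDerivation p A B γ δ with hE
  set Δ := A * δ - B * γ with hΔ
  have hEΔ : E (ofBase Δ) = 0 := by
    rw [hE, sectionDerivation_ofBase, h, map_zero, mul_zero]
  have hX0 : X 0 ∈ E.nilpotentSubalgebra := by
    refine ⟨2, ?_⟩
    rw [← ofBase_X_zero, Function.iterate_succ_apply, Function.iterate_one, hE,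
      sectionDerivation_ofBase, slopeDerivation_X_zero, map_one, mul_one]
    exact hEΔ
  have hX1 : X 1 ∈ E.nilpotentSubalgebra := by
    refine ⟨2, ?_⟩
    rw [← ofBase_X_one, Function.iterate_succ_apply, Function.iterate_one, hE,
      sectionDerivation_ofBase, slopeDerivation_X_one, ofBase_C, mul_comm, Derivation.leibniz,
      derivation_C, ← hΔ, ← hE, hEΔ, smul_zero, smul_zero, add_zero]
  have hbase : ∀ φ, ofBase φ ∈ E.nilpotentSubalgebra := by
    intro φ
    induction φ using MvPolynomial.induction_on with
    | C r => rw [ofBase_C]; exact algebraMap_mem E.nilpotentSubalgebra r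
    | add f g hf hg => rw [map_add]; exact add_mem hf hg
    | mul_X f i hf =>
      rw [map_mul]
      refine mul_mem hf ?_
      fin_cases i
      · simpa only [Fin.zero_eta, ofBase_X_zero] using hX0
      · simpa only [Fin.mk_one, ofBase_X_one] using hX1
  have hF : sectionForm A B ∈ E.nilpotentSubalgebra :=
    ⟨1, sectionDerivation_sectionForm_left p A B γ δ⟩
  have hG : sectionForm γ δ ∈ E.nilpotentSubalgebra :=
    ⟨1, sectionDerivation_sectionForm_right p A B γ δ⟩
  -- A nonzero kernel element pulls out of all iterates, hence cancels in a domain.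
  have hcancel : ∀ x, ofBase Δ * x ∈ E.nilpotentSubalgebra → x ∈ E.nilpotentSubalgebra := by
    rintro x ⟨k, hk⟩
    refine ⟨k, ?_⟩
    rw [E.iterate_mul_of_eq_zero hEΔ] at hk
    refine (mul_eq_zero.1 hk).resolve_left fun h => h0 (ofBase_injective ?_)
    rw [h, map_zero]
  have hX2 : X 2 ∈ E.nilpotentSubalgebra := by
    refine hcancel _ ?_
    have : ofBase Δ * X 2 = ofBase δ * sectionForm A B - ofBase B * sectionForm γ δ := by
      simp only [hΔ, sectionForm, map_sub, map_mul]; ring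
    rw [this]
    exact sub_mem (mul_mem (hbase _) hF) (mul_mem (hbase _) hG)
  have hX3 : X 3 ∈ E.nilpotentSubalgebra := by
    refine hcancel _ ?_
    have : ofBase Δ * X 3 = ofBase A * sectionForm γ δ - ofBase γ * sectionForm A B := by
      simp only [hΔ, sectionForm, map_sub, map_mul]; ring
    rw [this]
    exact sub_mem (mul_mem (hbase _) hG) (mul_mem (hbase _) hF)
  suffices G ∈ E.nilpotentSubalgebra from this
  induction G using MvPolynomial.induction_on with
  | C r => exact algebraMap_mem E.nilpotentSubalgebra r
  | add f g hf hg => exact add_mem hf hg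
  | mul_X f i hf =>
    refine mul_mem hf ?_
    fin_cases i
    exacts [hX0, hX1, hX2, hX3]

lemma mkDerivation_isBihomogeneous {d : ℕ} {f : Fin 4 → MvPolynomial (Fin 4) ℂ} {e c : ℤ × ℤ}
    (hf : ∀ i, IsBihomogeneous d (f i) (weight d i + e)) {G : MvPolynomial (Fin 4) ℂ}
    (hG : IsBihomogeneous d G c) : IsBihomogeneous d (mkDerivation ℂ f G) (c + e) := by
  induction hG using IsWeightedHomogeneous.induction_on with
  | zero => rw [map_zero]; exact isWeightedHomogeneous_zero _ _ _
  | add p q hp hq ih1 ih2 => rw [map_add]; exact ih1.add ih2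
  | monomial s r hw =>
    rw [mkDerivation_monomial, smul_eq_C_mul]
    refine IsWeightedHomogeneous.C_mul (IsWeightedHomogeneous.sum _ _ _ fun i hi => ?_) _
    have h1 : IsBihomogeneous d (monomial (s - Finsupp.single i 1) (s i : ℂ)) (c - weight d i) := by
      refine isWeightedHomogeneous_monomial _ _ _ ?_
      have hs : s - Finsupp.single i 1 + Finsupp.single i 1 = s :=
        tsub_add_cancel_of_le (Finsupp.single_le_iff.2
          (Nat.one_le_iff_ne_zero.2 (Finsupp.mem_support_iff.1 hi)))
      rw [← hw]
      conv_rhs => rw [← hs]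
      rw [map_add, Finsupp.weight_single, one_smul, add_sub_cancel_right]
    exact isBihomogeneous_congr (h1.mul (hf i)) (by ring)

/-- The degree n - 1 is an integer: for n = 0 it is -1 and the derivative of the constant is 0,
homogeneous of every degree. This occurs for γ when m = 0. -/
lemma ofBase_slopeDerivation_isBihomogeneous (p : ℂ) (d : ℕ) {φ : MvPolynomial (Fin 2) ℂ} {n : ℕ}
    (h : φ.IsHomogeneous n) : IsBihomogeneous d (ofBase (slopeDerivation p φ)) ((n : ℤ) - 1, 0) := by
  rcases n with _ | n
  · rw [← totalDegree_zero_iff_isHomogeneous, totalDegree_eq_zero_iff_eq_C] at h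
    rw [h, derivation_C, map_zero]
    exact isWeightedHomogeneous_zero _ _ _
  · exact isBihomogeneous_congr (ofBase_isBihomogeneous d (slopeDerivation_isHomogeneous p h))
      (by simp)

lemma sectionDerivation_isBihomogeneous {m d : ℕ} (hA : A.IsHomogeneous (m + 1))
    (hB : B.IsHomogeneous (m + d + 1)) (hγ : γ.IsHomogeneous m) (hδ : δ.IsHomogeneous (m + d))
    {G : MvPolynomial (Fin 4) ℂ} {c : ℤ × ℤ} (hG : IsBihomogeneous d G c) :
    IsBihomogeneous d (sectionDerivation p A B γ δ G) (c + (((2 * m + d : ℕ) : ℤ), (0 : ℤ))) := by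
  have hΔ : IsBihomogeneous d (ofBase (A * δ - B * γ)) (2 * m + d + 1, 0) := by
    refine isBihomogeneous_congr (ofBase_isBihomogeneous d (n := 2 * m + d + 1) ?_) (by simp)
    refine IsHomogeneous.sub ?_ ?_
    · convert! hA.mul hδ using 1; ring
    · convert! hB.mul hγ using 1; ring
  have h1 := sectionForm_isBihomogeneous (ofBase_slopeDerivation_isBihomogeneous p d hA)
    (ofBase_slopeDerivation_isBihomogeneous p d hB) (by push_cast; ring)
  have h2 := sectionForm_isBihomogeneous (ofBase_slopeDerivation_isBihomogeneous p d hγ)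
    (ofBase_slopeDerivation_isBihomogeneous p d hδ) (by push_cast; ring)
  have hA' := ofBase_isBihomogeneous d hA
  have hB' := ofBase_isBihomogeneous d hB
  have hγ' := ofBase_isBihomogeneous d hγ
  have hδ' := ofBase_isBihomogeneous d hδ
  refine mkDerivation_isBihomogeneous (fun i => ?_) hG
  fin_cases i
  · exact isBihomogeneous_congr hΔ (by ext <;> simp [weight]; ring)
  · exact isBihomogeneous_congr (hΔ.C_mul _) (by ext <;> simp [weight]; ring)
  · refine IsWeightedHomogeneous.sub (isBihomogeneous_congr (hB'.mul h2) ?_)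
      (isBihomogeneous_congr (hδ'.mul h1) ?_)
    · ext <;> simp [weight]; ring
    · ext <;> simp [weight]; ring
  · refine IsWeightedHomogeneous.sub (isBihomogeneous_congr (hγ'.mul h1) ?_)
      (isBihomogeneous_congr (hA'.mul h2) ?_)
    · ext <;> simp [weight]; ring
    · ext <;> simp [weight]; ring

end

/-! ## Regular functions on the complement of a divisor -/

namespace HirzebruchSurface

variable {d : ℕ} {F : MvPolynomial (Fin 4) ℂ} {c : ℤ × ℤ}

lemma mk_mem_zeroLocus (hF : IsBihomogeneous d F c) {z : Fin 4 → ℂ} (hz : InCone z) :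
    mk d z hz ∈ zeroLocus d F ↔ eval z F = 0 := by
  refine ⟨fun h => h z hz rfl, fun h y hy e => ?_⟩
  obtain ⟨l, m, hlm⟩ := Quotient.exact e.symm
  have hlm' : y = torusAct d l m z := hlm
  rw [hlm', eval_torusAct hF, h, mul_zero]

lemma mk_mem_compl_zeroLocus (hF : IsBihomogeneous d F c) {z : Fin 4 → ℂ} (hz : InCone z) :
    mk d z hz ∈ (zeroLocus d F)ᶜ ↔ eval z F ≠ 0 :=
  (mk_mem_zeroLocus hF hz).not

/-- `f` is the fraction `G / F ^ k` on the complement of `F = 0`. -/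
def IsFraction (d : ℕ) (F : MvPolynomial (Fin 4) ℂ) (c : ℤ × ℤ)
    (f : coordinateRing d (zeroLocus d F)ᶜ) (k : ℕ) (G : MvPolynomial (Fin 4) ℂ) : Prop :=
  IsBihomogeneous d G (k • c) ∧ ∀ (z : Fin 4 → ℂ) (hz : InCone z)
    (hV : mk d z hz ∈ (zeroLocus d F)ᶜ), f.1 ⟨mk d z hz, hV⟩ * eval z F ^ k = eval z G

namespace IsFraction

variable {f g : coordinateRing d (zeroLocus d F)ᶜ} {k l : ℕ} {G H : MvPolynomial (Fin 4) ℂ}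

lemma ext (hF : IsBihomogeneous d F c) (hf : IsFraction d F c f k G)
    (hg : IsFraction d F c g k G) : f = g := by
  apply Subtype.ext
  funext ⟨x, hx⟩
  obtain ⟨⟨z, hz⟩, rfl⟩ := Quotient.exists_rep x
  exact mul_right_cancel₀ (pow_ne_zero k ((mk_mem_compl_zeroLocus hF hz).1 hx))
    ((hf.2 z hz hx).trans (hg.2 z hz hx).symm)

lemma add (hf : IsFraction d F c f k G) (hg : IsFraction d F c g k H) :
    IsFraction d F c (f + g) k (G + H) := by
  refine ⟨hf.1.add hg.1, fun z hz hV => ?_⟩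
  rw [map_add, ← hf.2 z hz hV, ← hg.2 z hz hV]
  exact add_mul _ _ _

lemma mul (hf : IsFraction d F c f k G) (hg : IsFraction d F c g l H) :
    IsFraction d F c (f * g) (k + l) (G * H) := by
  refine ⟨isBihomogeneous_congr (hf.1.mul hg.1) (add_smul _ _ _).symm, fun z hz hV => ?_⟩
  rw [map_mul, ← hf.2 z hz hV, ← hg.2 z hz hV, pow_add]
  exact mul_mul_mul_comm _ _ _ _

lemma algebraMap (r : ℂ) : IsFraction d F c (algebraMap ℂ _ r) 0 (C r) := by
  refine ⟨isBihomogeneous_congr (isWeightedHomogeneous_C _ _) (zero_smul _ _).symm,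
    fun z hz hV => ?_⟩
  rw [pow_zero, mul_one, eval_C]
  rfl

lemma smul (r : ℂ) (hf : IsFraction d F c f k G) : IsFraction d F c (r • f) k (r • G) := by
  have := (algebraMap (d := d) (F := F) (c := c) r).mul hf
  rwa [zero_add, ← Algebra.smul_def, ← smul_eq_C_mul] at this

lemma pow (hf : IsFraction d F c f k G) (n : ℕ) : IsFraction d F c (f ^ n) (n * k) (G ^ n) := by
  induction n with
  | zero => simpa using algebraMap (d := d) (F := F) (c := c) 1
  | succ n ih => rw [pow_succ, pow_succ, Nat.succ_mul]; exact ih.mul hf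

lemma self_pow (hF : IsBihomogeneous d F c) (n : ℕ) : IsFraction d F c 1 n (F ^ n) := by
  refine ⟨hF.pow n, fun z hz hV => ?_⟩
  rw [map_pow]
  exact one_mul _

lemma pow_mul (hF : IsBihomogeneous d F c) (hf : IsFraction d F c f k G) (n : ℕ) :
    IsFraction d F c f (n + k) (F ^ n * G) := by
  simpa using (self_pow hF n).mul hf

lemma of_pow_mul (hF : IsBihomogeneous d F c) {n : ℕ} (hf : IsFraction d F c f (n + k) (F ^ n * G))
    (hG : IsBihomogeneous d G (k • c)) : IsFraction d F c f k G := by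
  refine ⟨hG, fun z hz hV => ?_⟩
  have h := hf.2 z hz hV
  rw [map_mul, map_pow] at h
  refine mul_left_cancel₀ (pow_ne_zero n ((mk_mem_compl_zeroLocus hF hz).1 hV)) ?_
  rw [← h]; ring

lemma mul_pow_eq (hF0 : F ≠ 0) (hcone : ∀ z, eval z F ≠ 0 → InCone z) (hF : IsBihomogeneous d F c)
    (hG : IsFraction d F c f k G) (hH : IsFraction d F c f l H) : F ^ l * G = F ^ k * H := by
  -- The extra factor F makes both sides vanish where F = 0, where the fractions give no
  -- information.
  refine mul_left_cancel₀ hF0 (MvPolynomial.funext fun z => ?_)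
  by_cases h : eval z F = 0
  · rw [map_mul, h, zero_mul, map_mul, h, zero_mul]
  have hV := (mk_mem_compl_zeroLocus hF (hcone z h)).2 h
  simp only [map_mul, map_pow, ← hG.2 z (hcone z h) hV, ← hH.2 z (hcone z h) hV]
  ring

lemma eq_of_eq (hF0 : F ≠ 0) (hcone : ∀ z, eval z F ≠ 0 → InCone z) (hF : IsBihomogeneous d F c)
    (hG : IsFraction d F c f k G) (hH : IsFraction d F c f k H) : G = H :=
  mul_left_cancel₀ (pow_ne_zero k hF0) (hG.mul_pow_eq hF0 hcone hF hH)

end IsFraction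

lemma exists_eq_isFraction (hF : IsBihomogeneous d F c) {k : ℕ} {G : MvPolynomial (Fin 4) ℂ}
    (hG : IsBihomogeneous d G (k • c)) : ∃ f, IsFraction d F c f k G := by
  let f₀ : HirzebruchSurface d → ℂ := fun x => eval x.out.1 G / eval x.out.1 F ^ k
  have h₀ : ∀ z hz, f₀ (mk d z hz) = eval z G / eval z F ^ k := by
    intro z hz
    obtain ⟨l, m, h⟩ := (Quotient.mk_out (s := hirzebruchSetoid d) ⟨z, hz⟩)
    have h' : z = torusAct d l m (mk d z hz).out.1 := h
    have h1 := eval_torusAct (hF.pow k) l m (mk d z hz).out.1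
    have h2 := eval_torusAct hG l m (mk d z hz).out.1
    rw [← h', map_pow, map_pow] at h1
    rw [← h'] at h2
    rw [h1, h2, mul_div_mul_left _ _ (Units.ne_zero _)]
  refine ⟨⟨fun x => f₀ x.1, fun z hz hV => ⟨k • c, G, F ^ k, hG, hF.pow k, ?_, ?_⟩⟩, hG, ?_⟩
  · rw [map_pow]
    exact pow_ne_zero _ ((mk_mem_compl_zeroLocus hF hz).1 hV)
  · intro y hy hV _
    simp only [h₀, map_pow]
  · intro z hz hV
    simp only [h₀]
    exact div_mul_cancel₀ _ (pow_ne_zero _ ((mk_mem_compl_zeroLocus hF hz).1 hV))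

/-- The ideal of denominators of a function on the complement of `F = 0`: it consists of the
polynomials all of whose bihomogeneous components are denominators. -/
noncomputable def denominatorIdeal (f : (((zeroLocus d F)ᶜ : Set (HirzebruchSurface d)) → ℂ)) :
    Ideal (MvPolynomial (Fin 4) ℂ) where
  carrier := {H | ∀ w, ∃ G, IsBihomogeneous d G w ∧ ∀ (z : Fin 4 → ℂ) (hz : InCone z)
    (hV : mk d z hz ∈ (zeroLocus d F)ᶜ),
      f ⟨mk d z hz, hV⟩ * eval z (weightedHomogeneousComponent (weight d) w H) = eval z G}
  zero_mem' w := ⟨0, isWeightedHomogeneous_zero _ _ _, by simp⟩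
  add_mem' := by
    intro H H' h h' w
    obtain ⟨G, hG, e⟩ := h w
    obtain ⟨G', hG', e'⟩ := h' w
    refine ⟨G + G', hG.add hG', fun z hz hV => ?_⟩
    rw [map_add, map_add, map_add, mul_add, e, e']
  smul_mem' := by
    intro p
    induction p using MvPolynomial.induction_on with
    | C r =>
      intro H h w
      obtain ⟨G, hG, e⟩ := h w
      refine ⟨C r * G, hG.C_mul r, fun z hz hV => ?_⟩
      rw [smul_eq_mul, weightedHomogeneousComponent_C_mul, map_mul, map_mul, ← e z hz hV]
      ring
    | add p q hp hq =>
      intro H h w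
      obtain ⟨G, hG, e⟩ := hp h w
      obtain ⟨G', hG', e'⟩ := hq h w
      refine ⟨G + G', hG.add hG', fun z hz hV => ?_⟩
      rw [add_smul, map_add, map_add, map_add, mul_add, e, e']
    | mul_X p i hp =>
      intro H h w
      obtain ⟨G, hG, e⟩ := hp h (w - weight d i)
      refine ⟨X i * G, isBihomogeneous_congr ((isBihomogeneous_X d i).mul hG) (by ring),
        fun z hz hV => ?_⟩
      rw [mul_comm p, mul_smul, smul_eq_mul (X i),
        show w = weight d i + (w - weight d i) by ring,
        weightedHomogeneousComponent_mul_of_left (isBihomogeneous_X d i), map_mul, map_mul,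
        ← e z hz hV]
      ring

/-- Local denominators generate an ideal whose common zeros lie in F = 0; points outside the cone
are harmless because F vanishes there. By the Nullstellensatz some power of F is itself a
denominator. -/
lemma exists_isFraction (hF : IsBihomogeneous d F c) (hcone : ∀ z, eval z F ≠ 0 → InCone z)
    (f : coordinateRing d (zeroLocus d F)ᶜ) : ∃ k G, IsFraction d F c f k G := by
  have hmem : F ∈ vanishingIdeal ℂ (MvPolynomial.zeroLocus ℂ (denominatorIdeal f.1)) := by
    intro z hz
    by_contra hFz
    rw [aeval_eq_eval] at hFz
    obtain ⟨w, G, H, hG, hH, h0, h⟩ :=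
      f.2 z (hcone z hFz) ((mk_mem_compl_zeroLocus hF (hcone z hFz)).2 hFz)
    -- The identity f H = G is known only where H ≠ 0, while f H² = G H holds on all of V.
    have hmem : H * H ∈ denominatorIdeal f.1 := by
      intro w'
      by_cases hw : w' = w + w
      · subst hw
        refine ⟨G * H, hG.mul hH, fun y hy hV => ?_⟩
        rw [(hH.mul hH).weightedHomogeneousComponent_same, map_mul, map_mul]
        by_cases hHy : eval y H = 0
        · simp [hHy]
        · rw [h y hy hV hHy]
          field_simp
      · refine ⟨0, isWeightedHomogeneous_zero _ _ _, fun y hy hV => ?_⟩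
        rw [(hH.mul hH).weightedHomogeneousComponent_ne _ hw]
        simp
    have := hz _ hmem
    rw [aeval_eq_eval, map_mul] at this
    exact h0 (mul_self_eq_zero.1 this)
  rw [vanishingIdeal_zeroLocus_eq_radical] at hmem
  obtain ⟨k, hk⟩ := hmem
  obtain ⟨G, hG, e⟩ := hk (k • c)
  refine ⟨k, G, hG, fun z hz hV => ?_⟩
  rw [← e z hz hV, (hF.pow k).weightedHomogeneousComponent_same, map_pow]

/-- A derivation of `ℂ[s, t, u, v]` that kills `F` and maps forms of degree `k • c` to forms of degree
`(k + r) • c` induces a derivation of the ring of regular functions outside `F = 0`. -/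
lemma exists_derivation_isFraction (hF : IsBihomogeneous d F c) (hF0 : F ≠ 0)
    (hcone : ∀ z, eval z F ≠ 0 → InCone z)
    (E : Derivation ℂ (MvPolynomial (Fin 4) ℂ) (MvPolynomial (Fin 4) ℂ)) (hEF : E F = 0) (r : ℕ)
    (hE : ∀ k G, IsBihomogeneous d G (k • c) → IsBihomogeneous d (E G) ((k + r) • c)) :
    ∃ D : Derivation ℂ (coordinateRing d (zeroLocus d F)ᶜ) (coordinateRing d (zeroLocus d F)ᶜ),
      ∀ f k G, IsFraction d F c f k G → IsFraction d F c (D f) (k + r) (E G) := by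
  have hex : ∀ f, ∃ g, ∀ k G, IsFraction d F c f k G → IsFraction d F c g (k + r) (E G) := by
    intro f
    obtain ⟨k, G, hG⟩ := exists_isFraction hF hcone f
    obtain ⟨g, hg⟩ := exists_eq_isFraction hF (hE k G hG.1)
    refine ⟨g, fun l H hH => ?_⟩
    refine IsFraction.of_pow_mul hF (n := k) ?_ (hE l H hH.1)
    -- As E kills F, applying E to F ^ l G = F ^ k H shows that the derivative does not depend on
    -- the chosen fraction.
    have h1 := congrArg E (hG.mul_pow_eq hF0 hcone hF hH)
    simp only [Derivation.leibniz, Derivation.leibniz_pow, hEF, smul_zero, add_zero,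
      smul_eq_mul, mul_zero] at h1
    rw [← h1]
    convert! hg.pow_mul hF l using 1
    ring
  choose D hD using hex
  have hadd : ∀ f g, D (f + g) = D f + D g := by
    intro f g
    obtain ⟨k, G, hG⟩ := exists_isFraction hF hcone f
    obtain ⟨l, H, hH⟩ := exists_isFraction hF hcone g
    have hG' := hG.pow_mul hF l
    have hH' := hH.pow_mul hF k
    rw [add_comm k l] at hH'
    refine (hD _ _ _ (hG'.add hH')).ext hF ?_
    rw [map_add]
    exact (hD _ _ _ hG').add (hD _ _ _ hH')
  have hsmul : ∀ (a : ℂ) f, D (a • f) = a • D f := by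
    intro a f
    obtain ⟨k, G, hG⟩ := exists_isFraction hF hcone f
    refine (hD _ _ _ (hG.smul a)).ext hF ?_
    rw [Derivation.map_smul]
    exact (hD _ _ _ hG).smul a
  refine ⟨Derivation.mk' { toFun := D, map_add' := hadd, map_smul' := hsmul } ?_, hD⟩
  intro f g
  obtain ⟨k, G, hG⟩ := exists_isFraction hF hcone f
  obtain ⟨l, H, hH⟩ := exists_isFraction hF hcone g
  refine (hD _ _ _ (hG.mul hH)).ext hF ?_
  rw [Derivation.leibniz, smul_eq_mul, smul_eq_mul, smul_eq_mul, smul_eq_mul]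
  have h1 := hG.mul (hD _ _ _ hH)
  have h2 := hH.mul (hD _ _ _ hG)
  rw [← add_assoc] at h1
  rw [← add_assoc, add_comm l k] at h2
  exact h1.add h2

end HirzebruchSurface

/-! ## The complement of an ample section -/

namespace HirzebruchSurface

lemma inCone_of_eval_sectionForm_ne_zero {A B : MvPolynomial (Fin 2) ℂ} {i j : ℕ}
    (hA : A.IsHomogeneous (i + 1)) (hB : B.IsHomogeneous (j + 1)) {z : Fin 4 → ℂ}
    (h : eval z (sectionForm A B) ≠ 0) : InCone z := by
  have aux : ∀ {φ : MvPolynomial (Fin 2) ℂ} {n : ℕ}, φ.IsHomogeneous (n + 1) →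
      z 0 = 0 ∧ z 1 = 0 → eval ![z 0, z 1] φ = 0 := by
    rintro φ n hφ ⟨h0, h1⟩
    rw [h0, h1, eval_eq']
    refine Finset.sum_eq_zero fun e he => ?_
    have := hφ (mem_support_iff.1 he)
    simp only [Finsupp.weight_apply, Finsupp.sum_fintype, Fin.sum_univ_two, Pi.one_apply,
      smul_eq_mul, mul_one, implies_true] at this
    rw [Fin.prod_univ_two]
    by_cases he0 : e 0 = 0
    · have : e 1 ≠ 0 := by omega
      simp [this]
    · simp [he0]
  constructor
  · intro hz
    refine h ?_
    simp [sectionForm, eval_ofBase, aux hA hz, aux hB hz]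
  · rintro ⟨h2, h3⟩
    refine h ?_
    simp [sectionForm, h2, h3]

lemma iterate_smul_derivation {R S : Type*} [CommRing R] [CommRing S] [Algebra R S]
    (E : Derivation R S S) {a : S} (ha : E a = 0) (k : ℕ) (x : S) :
    (a • E)^[k] x = a ^ k * E^[k] x := by
  induction k generalizing x with
  | zero => simp
  | succ k ih =>
    rw [Function.iterate_succ_apply, Function.iterate_succ_apply, ih, Derivation.smul_apply,
      smul_eq_mul, E.iterate_mul_of_eq_zero ha, pow_succ, mul_assoc]

section

variable {m d : ℕ} {A B : MvPolynomial (Fin 2) ℂ}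

lemma slopeDerivation_slopeForm_pow (p : ℂ) (k : ℕ) : slopeDerivation p (slopeForm p ^ k) = 0 := by
  rw [Derivation.leibniz_pow, slopeDerivation_slopeForm, sub_self, C_0, smul_zero, smul_zero]

/-- For every slope `p` there are a locally nilpotent derivation of the ring of regular functions
and a form that it kills and whose restriction to the section is `(X₁ - p X₀) ^ n`. -/
lemma exists_locallyNilpotent_derivation (hA : A.IsHomogeneous (m + 1))
    (hB : B.IsHomogeneous (m + d + 1)) (hF0 : sectionForm A B ≠ 0)
    (h : ∀ q : Fin 2 → ℂ, q ≠ 0 → eval q A = 0 → eval q B ≠ 0) (p : ℂ) :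
    ∃ D : Derivation ℂ (coordinateRing d (HirzebruchSurface.zeroLocus d (sectionForm A B))ᶜ)
        (coordinateRing d (HirzebruchSurface.zeroLocus d (sectionForm A B))ᶜ),
      IsLocallyNilpotent D ∧
      (∀ f k G, IsFraction d (sectionForm A B) (((m + 1 : ℕ) : ℤ), (1 : ℤ)) f k G → D f = 0 →
        slopeDerivation p (restrictToSection A B G) = 0) ∧
      ∃ f G, IsFraction d (sectionForm A B) (((m + 1 : ℕ) : ℤ), (1 : ℤ)) f 1 G ∧ D f = 0 ∧
        restrictToSection A B G = slopeForm p ^ (2 * m + d + 2) := by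
  have hF : IsBihomogeneous d (sectionForm A B) (((m + 1 : ℕ) : ℤ), (1 : ℤ)) :=
    sectionForm_isBihomogeneous (ofBase_isBihomogeneous d hA) (ofBase_isBihomogeneous d hB)
      (by push_cast; ring)
  have hcone : ∀ z, eval z (sectionForm A B) ≠ 0 → InCone z := fun z hz =>
    inCone_of_eval_sectionForm_ne_zero hA hB hz
  -- The exponent is the degree of A δ - B γ: (m + 1) + (m + d).
  obtain ⟨γ, δ, hγ, hδ, hΔ⟩ := exists_bezout_forms (τ := slopeForm p ^ (2 * m + d + 1)) hA hB
    (by convert! (slopeForm_isHomogeneous p).pow (2 * m + d + 1) using 1; ring) h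
  have hΔ0 : A * δ - B * γ ≠ 0 := by rw [hΔ]; exact pow_ne_zero _ (slopeForm_ne_zero p)
  have hΔ' : slopeDerivation p (A * δ - B * γ) = 0 := by
    rw [hΔ, slopeDerivation_slopeForm_pow]
  have hG : IsBihomogeneous d (sectionForm γ δ) ((m : ℤ), (1 : ℤ)) :=
    sectionForm_isBihomogeneous (ofBase_isBihomogeneous d hγ) (ofBase_isBihomogeneous d hδ)
      (by push_cast; ring)
  have hG0 : sectionForm γ δ ≠ 0 := fun h0 => hΔ0 (by
    rw [← restrictToSection_sectionForm, h0, map_zero])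
  set E := sectionDerivation p A B γ δ with hE
  have hEG : E (sectionForm γ δ ^ (2 * m + d)) = 0 := by
    rw [Derivation.leibniz_pow, hE, sectionDerivation_sectionForm_right, smul_zero, smul_zero]
  -- E has bidegree (2 m + d, 0) and γ u + δ v has bidegree (m, 1), so this power of it turns the
  -- shift into (2 m + d) (m + 1, 1). The multiplier lies in the kernel of E, so local nilpotency is
  -- kept.
  obtain ⟨D, hD⟩ := exists_derivation_isFraction hF hF0 hcone
    (sectionForm γ δ ^ (2 * m + d) • E)
    (by rw [Derivation.smul_apply, hE, sectionDerivation_sectionForm_left, smul_zero])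
    (2 * m + d) (fun k G' hG' => by
      refine isBihomogeneous_congr
        ((hG.pow (2 * m + d)).mul (sectionDerivation_isBihomogeneous hA hB hγ hδ hG')) ?_
      ext <;> simp <;> ring)
  have hD0 : ∀ f k G, IsFraction d (sectionForm A B) (((m + 1 : ℕ) : ℤ), (1 : ℤ)) f k G →
      (D f = 0 ↔ E G = 0) := by
    intro f k G' hG'
    have h1 := hD f k G' hG'
    rw [Derivation.smul_apply, smul_eq_mul] at h1
    have h0 : IsFraction d (sectionForm A B) (((m + 1 : ℕ) : ℤ), (1 : ℤ)) 0 (k + (2 * m + d)) 0 :=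
      ⟨isWeightedHomogeneous_zero _ _ _, fun z hz hV => by simp⟩
    constructor
    · intro h2
      rw [h2] at h1
      exact (mul_eq_zero.1 (h1.eq_of_eq hF0 hcone hF h0)).resolve_left (pow_ne_zero _ hG0)
    · intro h2
      rw [h2, mul_zero] at h1
      exact h1.ext hF h0
  refine ⟨D, fun f => ?_, fun f k G' hG' hf => ?_, ?_⟩
  · obtain ⟨k, G', hG'⟩ := exists_isFraction hF hcone f
    obtain ⟨n, hn⟩ := exists_iterate_sectionDerivation_eq_zero hΔ0 hΔ' G'
    have hit : ∀ j, IsFraction d (sectionForm A B) (((m + 1 : ℕ) : ℤ), (1 : ℤ)) ((D)^[j] f)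
        (k + j * (2 * m + d)) ((sectionForm γ δ ^ (2 * m + d) • E)^[j] G') := by
      intro j
      induction j with
      | zero => simpa using hG'
      | succ j ih =>
        rw [Function.iterate_succ_apply', Function.iterate_succ_apply', Nat.succ_mul, ← add_assoc]
        exact hD _ _ _ ih
    refine ⟨n, (hit n).ext hF ?_⟩
    rw [iterate_smul_derivation E hEG, hn, mul_zero]
    exact ⟨isWeightedHomogeneous_zero _ _ _, fun z hz hV => by simp⟩
  · have h1 := congrArg (restrictToSection A B) ((hD0 f k G' hG').1 hf)
    rw [hE, restrictToSection_sectionDerivation hΔ', map_zero] at h1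
    exact (mul_eq_zero.1 h1).resolve_left hΔ0
  -- The kernel element is ℓ (γ u + δ v) / F with ℓ = X₁ - p X₀; its numerator restricts to ℓ Δ.
  · have hG1 : IsBihomogeneous d (ofBase (slopeForm p) * sectionForm γ δ)
        (1 • (((m + 1 : ℕ) : ℤ), (1 : ℤ))) := by
      refine isBihomogeneous_congr ((ofBase_isBihomogeneous d (slopeForm_isHomogeneous p)).mul hG) ?_
      ext <;> simp; ring
    obtain ⟨f, hf⟩ := exists_eq_isFraction hF hG1
    refine ⟨f, _, hf, (hD0 _ _ _ hf).2 ?_, ?_⟩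
    · have := slopeDerivation_slopeForm_pow p 1
      rw [pow_one] at this
      rw [Derivation.leibniz, hE, sectionDerivation_sectionForm_right, sectionDerivation_ofBase,
        this, map_zero, mul_zero, smul_zero, smul_zero, add_zero]
    · rw [map_mul, restrictToSection_ofBase, restrictToSection_sectionForm, hΔ]
      ring

lemma exists_isFraction_of_restrictToSection_eq_zero (hA : A.IsHomogeneous (m + 1))
    (hB : B.IsHomogeneous (m + d + 1)) (hA0 : A ≠ 0) (hprime : Prime (sectionForm A B))
    {f : coordinateRing d (HirzebruchSurface.zeroLocus d (sectionForm A B))ᶜ} {k : ℕ}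
    {G : MvPolynomial (Fin 4) ℂ}
    (hf : IsFraction d (sectionForm A B) (((m + 1 : ℕ) : ℤ), (1 : ℤ)) f (k + 1) G)
    (h : restrictToSection A B G = 0) :
    ∃ H, IsFraction d (sectionForm A B) (((m + 1 : ℕ) : ℤ), (1 : ℤ)) f k H := by
  have hF : IsBihomogeneous d (sectionForm A B) (((m + 1 : ℕ) : ℤ), (1 : ℤ)) :=
    sectionForm_isBihomogeneous (ofBase_isBihomogeneous d hA) (ofBase_isBihomogeneous d hB)
      (by push_cast; ring)
  obtain ⟨H, hH, rfl⟩ := exists_isBihomogeneous_of_dvd hF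
    (isBihomogeneous_congr hf.1 (succ_nsmul' _ _))
    (sectionForm_dvd_of_restrictToSection_eq_zero hprime hA0 _ hf.1 h)
  refine ⟨H, IsFraction.of_pow_mul hF (n := 1) ?_ hH⟩
  rwa [pow_one, add_comm 1 k]

theorem derksenInvariant_compl_sectionForm (hA : A.IsHomogeneous (m + 1))
    (hB : B.IsHomogeneous (m + d + 1)) (hA0 : A ≠ 0) (hprime : Prime (sectionForm A B))
    (h : ∀ q : Fin 2 → ℂ, q ≠ 0 → eval q A = 0 → eval q B ≠ 0) :
    derksenInvariant
      (coordinateRing d (HirzebruchSurface.zeroLocus d (sectionForm A B))ᶜ) = ⊤ := by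
  have hF : IsBihomogeneous d (sectionForm A B) (((m + 1 : ℕ) : ℤ), (1 : ℤ)) :=
    sectionForm_isBihomogeneous (ofBase_isBihomogeneous d hA) (ofBase_isBihomogeneous d hB)
      (by push_cast; ring)
  have hcone : ∀ z, eval z (sectionForm A B) ≠ 0 → InCone z := fun z hz =>
    inCone_of_eval_sectionForm_ne_zero hA hB hz
  have hgen : ∀ p : ℂ, ∃ f G, f ∈ derksenInvariant
      (coordinateRing d (HirzebruchSurface.zeroLocus d (sectionForm A B))ᶜ) ∧
      IsFraction d (sectionForm A B) (((m + 1 : ℕ) : ℤ), (1 : ℤ)) f 1 G ∧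
      restrictToSection A B G = slopeForm p ^ (2 * m + d + 2) := by
    intro p
    obtain ⟨D, hD, hker, f, G, hf, hDf, hG⟩ :=
      exists_locallyNilpotent_derivation hA hB hprime.ne_zero h p
    refine ⟨f, G, Algebra.subset_adjoin ⟨D, hD, ?_, hDf⟩, hf, hG⟩
    rintro rfl
    -- The zero derivation would also kill the function attached to the slope p + 1, but ∂₀ + p ∂₁
    -- does not kill that power of X₁ - (p + 1) X₀.
    obtain ⟨-, -, -, g, H, hg, -, hH⟩ :=
      exists_locallyNilpotent_derivation hA hB hprime.ne_zero h (p + 1)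
    have h1 := hker g 1 H hg rfl
    rw [hH, Derivation.leibniz_pow, slopeDerivation_slopeForm, smul_eq_mul,
      smul_eq_zero] at h1
    refine mul_ne_zero (pow_ne_zero _ (slopeForm_ne_zero (p + 1))) ?_
      (h1.resolve_left (by positivity))
    rw [C_ne_zero]
    simp
  have hspan : ∀ k, ∀ φ ∈ Submodule.span ℂ
      (Set.range fun p : ℂ => slopeForm p ^ (k * (2 * m + d + 2))),
      ∃ f G, f ∈ derksenInvariant
        (coordinateRing d (HirzebruchSurface.zeroLocus d (sectionForm A B))ᶜ) ∧
        IsFraction d (sectionForm A B) (((m + 1 : ℕ) : ℤ), (1 : ℤ)) f k G ∧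
        restrictToSection A B G = φ := by
    intro k φ hφ
    induction hφ using Submodule.span_induction with
    | mem x hx =>
      obtain ⟨p, rfl⟩ := hx
      obtain ⟨f, G, hf, hfG, hG⟩ := hgen p
      refine ⟨f ^ k, G ^ k, pow_mem hf k, by simpa using hfG.pow k, ?_⟩
      rw [map_pow, hG, ← pow_mul, mul_comm]
    | zero =>
      exact ⟨0, 0, zero_mem _, ⟨isWeightedHomogeneous_zero _ _ _, fun z hz hV => by simp⟩,
        map_zero _⟩
    | add x y _ _ ihx ihy =>
      obtain ⟨f, G, hf, hfG, rfl⟩ := ihx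
      obtain ⟨g, H, hg, hgH, rfl⟩ := ihy
      exact ⟨f + g, G + H, add_mem hf hg, hfG.add hgH, map_add _ _ _⟩
    | smul r x _ ih =>
      obtain ⟨f, G, hf, hfG, rfl⟩ := ih
      exact ⟨r • f, r • G, Subalgebra.smul_mem _ hf r, hfG.smul r, map_smul _ _ _⟩
  have key : ∀ k f G, IsFraction d (sectionForm A B) (((m + 1 : ℕ) : ℤ), (1 : ℤ)) f k G →
      f ∈ derksenInvariant
        (coordinateRing d (HirzebruchSurface.zeroLocus d (sectionForm A B))ᶜ) := by
    intro k
    induction k with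
    | zero =>
      intro f G hf
      obtain ⟨r, rfl⟩ := exists_eq_C_of_isBihomogeneous_zero
        (isBihomogeneous_congr hf.1 (zero_nsmul _))
      rw [hf.ext hF (IsFraction.algebraMap r)]
      exact algebraMap_mem _ r
    | succ k ih =>
      intro f G hf
      -- Choose g in the Derksen invariant with the same leading term along S as f; then f - g has
      -- smaller pole order.
      obtain ⟨g, H, hg, hgH, e⟩ := hspan (k + 1) _
        (mem_span_slopeForm_pow (restrictToSection_isHomogeneous hA hB hf.1))
      have h1 := hf.add (hgH.smul (-1))
      obtain ⟨G', hG'⟩ := exists_isFraction_of_restrictToSection_eq_zero hA hB hA0 hprime h1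
        (by rw [map_add, map_smul, e, neg_one_smul, add_neg_cancel])
      have := add_mem (ih _ _ hG') hg
      rwa [neg_one_smul, neg_add_cancel_right] at this
  refine eq_top_iff.2 fun f _ => ?_
  obtain ⟨k, G, hf⟩ := exists_isFraction hF hcone f
  exact key k f G hf

theorem makarLimanovInvariant_compl_sectionForm (hA : A.IsHomogeneous (m + 1))
    (hB : B.IsHomogeneous (m + d + 1)) (hA0 : A ≠ 0) (hprime : Prime (sectionForm A B))
    (h : ∀ q : Fin 2 → ℂ, q ≠ 0 → eval q A = 0 → eval q B ≠ 0) :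
    makarLimanovInvariant
      (coordinateRing d (HirzebruchSurface.zeroLocus d (sectionForm A B))ᶜ) = ⊥ := by
  have hF : IsBihomogeneous d (sectionForm A B) (((m + 1 : ℕ) : ℤ), (1 : ℤ)) :=
    sectionForm_isBihomogeneous (ofBase_isBihomogeneous d hA) (ofBase_isBihomogeneous d hB)
      (by push_cast; ring)
  have hcone : ∀ z, eval z (sectionForm A B) ≠ 0 → InCone z := fun z hz =>
    inCone_of_eval_sectionForm_ne_zero hA hB hz
  refine eq_bot_iff.2 fun f hf => ?_
  obtain ⟨k, G, hG⟩ := exists_isFraction hF hcone f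
  induction k generalizing G with
  | zero =>
    obtain ⟨r, rfl⟩ := exists_eq_C_of_isBihomogeneous_zero
      (isBihomogeneous_congr hG.1 (zero_nsmul _))
    rw [hG.ext hF (IsFraction.algebraMap r)]
    exact algebraMap_mem _ r
  | succ k ih =>
    have hp : ∀ p, slopeDerivation p (restrictToSection A B G) = 0 := by
      intro p
      obtain ⟨D, hD, hker, -⟩ := exists_locallyNilpotent_derivation hA hB hprime.ne_zero h p
      exact hker f _ G hG (hf D hD)
    -- Two slopes suffice to make both partial derivatives vanish; Euler's identity then applies in
    -- positive degree.
    have h0 := hp 0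
    have h1 := hp 1
    simp only [slopeDerivation, Derivation.add_apply, zero_smul, add_zero, one_smul] at h0 h1
    rw [h0, zero_add] at h1
    have h2 := (restrictToSection_isHomogeneous hA hB hG.1).sum_X_mul_pderiv
    rw [Fin.sum_univ_two, h0, h1, mul_zero, mul_zero, add_zero] at h2
    have h3 := (smul_eq_zero.1 h2.symm).resolve_left (by positivity)
    obtain ⟨H, hH⟩ := exists_isFraction_of_restrictToSection_eq_zero hA hB hA0 hprime hG h3
    exact ih H hH

end

end HirzebruchSurface

/-! ## Ample sections as zero loci of forms `A u + B v` -/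

namespace HirzebruchSurface

variable {d : ℕ}

/-- On the curve v = 0, forms of bidegree (a, b) with a ≤ 0 reduce to constant multiples of a power
of u, so they cannot separate two of its points with u = 1. -/
lemma pos_of_isVeryAmple {a b : ℤ} (h : IsVeryAmple d (a, b)) : 0 < a := by
  by_contra! ha
  have hz : InCone ![1, 0, 1, 0] := by constructor <;> simp
  have hz' : InCone ![0, 1, 1, 0] := by constructor <;> simp
  obtain ⟨G, hG, h0, h1⟩ := h.1 _ _ hz hz' (fun e => by
    obtain ⟨l, m, hlm⟩ := Quotient.exact e
    have hlm' : (![0, 1, 1, 0] : Fin 4 → ℂ) = torusAct d l m ![1, 0, 1, 0] := hlm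
    have := congrFun hlm' 1
    simp [torusAct] at this)
  refine h1 (Eq.trans ?_ h0)
  rw [eval_eq', eval_eq']
  refine Finset.sum_congr rfl fun e he => ?_
  have hw := hG (mem_support_iff.1 he)
  rw [weight_eq, Prod.ext_iff] at hw
  simp only at hw
  simp only [Fin.prod_univ_four, Matrix.cons_val, one_pow, one_mul, mul_one]
  by_cases h3 : e 3 = 0
  · rw [h3] at hw ⊢
    have h0 : e 0 = 0 := by omega
    have h1 : e 1 = 0 := by omega
    rw [h0, h1]
  · rw [zero_pow h3]; simp

/-- The substitution `u ↦ T u`, `v ↦ T v` at a point. -/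
noncomputable def fibreScaling (z : Fin 4 → ℂ) : MvPolynomial (Fin 4) ℂ →ₐ[ℂ] Polynomial ℂ :=
  aeval ![Polynomial.C (z 0), Polynomial.C (z 1), Polynomial.C (z 2) * Polynomial.X,
    Polynomial.C (z 3) * Polynomial.X]

lemma fibreScaling_of_isBihomogeneous {G : MvPolynomial (Fin 4) ℂ} {a : ℤ} {b : ℕ}
    (hG : IsBihomogeneous d G (a, b)) (z : Fin 4 → ℂ) :
    fibreScaling z G = Polynomial.C (eval z G) * Polynomial.X ^ b := by
  induction hG using IsWeightedHomogeneous.induction_on with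
  | zero => simp
  | add p q hp hq h1 h2 => rw [map_add, h1, h2, map_add, map_add, add_mul]
  | monomial e r hw =>
    rw [weight_eq, Prod.ext_iff] at hw
    simp only at hw
    have hb : b = e 2 + e 3 := by omega
    rw [fibreScaling, aeval_monomial, eval_monomial, Finsupp.prod_fintype _ _ (by simp),
      Finsupp.prod_fintype _ _ (by simp), Fin.prod_univ_four, Fin.prod_univ_four, hb]
    simp only [Matrix.cons_val, Polynomial.algebraMap_apply, Algebra.algebraMap_self,
      RingHom.id_apply, map_mul, map_pow]
    ring

lemma fibreScaling_ofBase (z : Fin 4 → ℂ) (φ : MvPolynomial (Fin 2) ℂ) :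
    fibreScaling z (ofBase φ) = Polynomial.C (eval ![z 0, z 1] φ) := by
  induction φ using MvPolynomial.induction_on with
  | C r => rw [ofBase_C, eval_C, fibreScaling, aeval_C]; rfl
  | add p q hp hq => simp only [map_add, hp, hq]
  | mul_X p i hp =>
    rw [map_mul, map_mul, hp, map_mul, map_mul]
    congr 1
    fin_cases i
    · simp [ofBase_X_zero, fibreScaling]
    · simp [ofBase_X_one, fibreScaling]

/-- The degree in `(u, v)` of a bihomogeneous divisor of `H` is at most that of `H`. -/
lemma le_of_dvd_fibreScaling {F H : MvPolynomial (Fin 4) ℂ} {a : ℤ} {b k : ℕ}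
    (hF : IsBihomogeneous d F (a, b)) (hH : H ≠ 0)
    (hk : ∀ z, (fibreScaling z H).natDegree ≤ k)
    (h1 : ∀ z, (fibreScaling z H).eval 1 = eval z H) (h : F ∣ H) : b ≤ k := by
  obtain ⟨z, hz⟩ : ∃ z, eval z H ≠ 0 := by
    by_contra! hz
    exact hH (MvPolynomial.funext fun z => by rw [hz, map_zero])
  obtain ⟨K, rfl⟩ := h
  have hne : fibreScaling z (F * K) ≠ 0 := by
    intro h0
    rw [← h1, h0, Polynomial.eval_zero] at hz
    exact hz rfl
  refine le_trans ?_ (hk z)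
  rw [map_mul] at hne ⊢
  rw [Polynomial.natDegree_mul (left_ne_zero_of_mul hne) (right_ne_zero_of_mul hne)]
  have hF0 : eval z F ≠ 0 := by rw [map_mul] at hz; exact left_ne_zero_of_mul hz
  rw [fibreScaling_of_isBihomogeneous hF, Polynomial.natDegree_C_mul_X_pow _ _ hF0]
  omega

/-- A form of degree one in `(u, v)` is `A u + B v` with binary forms `A` and `B`. -/
lemma exists_eq_sectionForm {m : ℕ} {F : MvPolynomial (Fin 4) ℂ}
    (hF : IsBihomogeneous d F ((m : ℤ), (1 : ℤ))) :
    ∃ A B : MvPolynomial (Fin 2) ℂ, A.IsHomogeneous m ∧ B.IsHomogeneous (m + d) ∧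
      F = sectionForm A B := by
  induction hF using IsWeightedHomogeneous.induction_on with
  | zero =>
    exact ⟨0, 0, isHomogeneous_zero _ _ _, isHomogeneous_zero _ _ _, by simp [sectionForm]⟩
  | add p q hp hq h1 h2 =>
    obtain ⟨A, B, hA, hB, rfl⟩ := h1
    obtain ⟨A', B', hA', hB', rfl⟩ := h2
    exact ⟨A + A', B + B', hA.add hA', hB.add hB', by simp only [sectionForm, map_add]; ring⟩
  | monomial e r hw =>
    rw [weight_eq, Prod.ext_iff] at hw
    simp only at hw
    have hhom : ∀ n, e 0 + e 1 = n →
        (C r * (X 0 ^ e 0 * X 1 ^ e 1) : MvPolynomial (Fin 2) ℂ).IsHomogeneous n := by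
      rintro n rfl
      refine IsHomogeneous.C_mul ?_ _
      convert! ((isHomogeneous_X ℂ (0 : Fin 2)).pow (e 0)).mul
        ((isHomogeneous_X ℂ (1 : Fin 2)).pow (e 1)) using 1
      ring
    by_cases h3 : e 3 = 0
    · have h2 : e 2 = 1 := by omega
      rw [h3] at hw
      refine ⟨C r * (X 0 ^ e 0 * X 1 ^ e 1), 0, hhom _ (by omega), isHomogeneous_zero _ _ _, ?_⟩
      rw [monomial_eq, Finsupp.prod_fintype _ _ (by simp), Fin.prod_univ_four, h2, h3]
      simp only [sectionForm, map_mul, map_pow, ofBase_C, ofBase_X_zero, ofBase_X_one, map_zero]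
      ring
    · have h2 : e 2 = 0 := by omega
      have h3 : e 3 = 1 := by omega
      rw [h3] at hw
      refine ⟨0, C r * (X 0 ^ e 0 * X 1 ^ e 1), isHomogeneous_zero _ _ _,
        hhom _ (by push_cast at hw; omega), ?_⟩
      rw [monomial_eq, Finsupp.prod_fintype _ _ (by simp), Fin.prod_univ_four, h2, h3]
      simp only [sectionForm, map_mul, map_pow, ofBase_C, ofBase_X_zero, ofBase_X_one, map_zero]
      ring

end HirzebruchSurface

/-! ### Equations of sections -/

namespace HirzebruchSurface

variable {d : ℕ}

lemma ruling_mk {z : Fin 4 → ℂ} (hz : InCone z) :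
    ruling d (mk d z hz) = Projectivization.mk ℂ ![z 0, z 1] (fst_ne_zero hz) := rfl

lemma inCone_of_ne_zero {q : Fin 2 → ℂ} (hq : q ≠ 0) {u v : ℂ} (h : ¬ (u = 0 ∧ v = 0)) :
    InCone ![q 0, q 1, u, v] := by
  refine ⟨fun ⟨h0, h1⟩ => hq ?_, h⟩
  ext i
  fin_cases i
  exacts [h0, h1]

lemma mul_eq_mul_of_mk_eq_mk {q : Fin 2 → ℂ} {u v u' v' : ℂ} (hq : q ≠ 0)
    (hz : InCone ![q 0, q 1, u, v]) (hz' : InCone ![q 0, q 1, u', v'])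
    (h : mk d _ hz = mk d _ hz') : u' * v = v' * u := by
  obtain ⟨l, m, hlm⟩ := Quotient.exact h
  have hlm' : (![q 0, q 1, u', v'] : Fin 4 → ℂ) = torusAct d l m ![q 0, q 1, u, v] := hlm
  have h0 : q 0 = l * q 0 := congrFun hlm' 0
  have h1 : q 1 = l * q 1 := congrFun hlm' 1
  have h2 : u' = m * u := congrFun hlm' 2
  have h3 : v' = ((l⁻¹ ^ d * m : ℂˣ) : ℂ) * v := congrFun hlm' 3
  have hl : l = 1 := by
    rw [← Units.val_inj, Units.val_one]
    by_cases hq0 : q 0 = 0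
    · have hq1 : q 1 ≠ 0 := fun hq1 => hq (by ext i; fin_cases i; exacts [hq0, hq1])
      exact mul_right_cancel₀ hq1 (by rw [← h1, one_mul])
    · exact mul_right_cancel₀ hq0 (by rw [← h0, one_mul])
  rw [hl, inv_one, one_pow, one_mul] at h3
  rw [h2, h3]
  ring

/-- Near `p` a section is `[q : M(q) : N(q)]` with binary forms `M` and `N`. -/
lemma exists_local_equation {σ : Projectivization ℂ (Fin 2 → ℂ) → HirzebruchSurface d}
    (hσ : IsRegularMap d σ) (hr : ∀ p, ruling d (σ p) = p) {p : Fin 2 → ℂ} (hp : p ≠ 0) :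
    ∃ h M N : MvPolynomial (Fin 2) ℂ, eval p h ≠ 0 ∧ ∀ (q : Fin 2 → ℂ) (hq : q ≠ 0),
      eval q h ≠ 0 → ∃ hz : InCone ![q 0, q 1, eval q M, eval q N],
        σ (Projectivization.mk ℂ q hq) = mk d _ hz := by
  obtain ⟨e, h, A, -, hh, hA⟩ := hσ p hp
  have hprop : ∀ q : Fin 2 → ℂ, q ≠ 0 → eval q h ≠ 0 →
      q 1 * eval q (A 0) = q 0 * eval q (A 1) := by
    intro q hq hhq
    obtain ⟨hz, e⟩ := hA q hq hhq
    have := hr (Projectivization.mk ℂ q hq)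
    rw [e, ruling_mk, Projectivization.mk_eq_mk_iff] at this
    obtain ⟨l, hl⟩ := this
    have h0 : l * q 0 = eval q (A 0) := congrFun hl 0
    have h1 : l * q 1 = eval q (A 1) := congrFun hl 1
    rw [← h0, ← h1]
    ring
  have hh0 : h ≠ 0 := by rintro rfl; simp at hh
  -- The ruling condition says that (A₀, A₁) is proportional to (X₀, X₁); hence A₀ = X₀ Λ and A₁ =
  -- X₁ Λ.
  have hpoly : X 1 * A 0 = X 0 * A 1 := by
    refine mul_left_cancel₀ hh0 (MvPolynomial.funext fun q => ?_)
    simp only [map_mul, eval_X]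
    by_cases hq : q = 0
    · simp [hq]
    by_cases hhq : eval q h = 0
    · simp [hhq]
    · rw [hprop q hq hhq]
  obtain ⟨Λ, hΛ⟩ : X 0 ∣ A 0 := by
    refine ((X_prime (R := ℂ) (i := (0 : Fin 2))).dvd_or_dvd
      (Dvd.intro _ hpoly.symm)).resolve_left fun h01 => ?_
    rw [X_dvd_X] at h01
    simp at h01
  have hΛ' : A 1 = X 1 * Λ := by
    refine mul_left_cancel₀ (X_ne_zero (R := ℂ) (0 : Fin 2)) ?_
    rw [← hpoly, hΛ]
    ring
  -- Acting by (Λ⁻¹, 1) in the torus normalizes the base coordinates to q and multiplies v by Λ ^ d.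
  refine ⟨h, A 2, Λ ^ d * A 3, hh, fun q hq hhq => ?_⟩
  obtain ⟨hz, e⟩ := hA q hq hhq
  have hΛq : eval q Λ ≠ 0 := fun h0 => hz.1 (by simp [hΛ, hΛ', h0])
  have hz' : InCone ![q 0, q 1, eval q (A 2), eval q (Λ ^ d * A 3)] := by
    refine inCone_of_ne_zero hq fun ⟨h2, h3⟩ => hz.2 ⟨h2, ?_⟩
    rw [map_mul, map_pow] at h3
    exact (mul_eq_zero.1 h3).resolve_left (pow_ne_zero _ hΛq)
  refine ⟨hz', e.trans (Quotient.sound ⟨(Units.mk0 _ hΛq)⁻¹, 1, ?_⟩)⟩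
  ext i
  fin_cases i <;> simp [torusAct, hΛ, hΛ'] <;> field_simp

lemma dvd_of_eval_eq_zero {F H : MvPolynomial (Fin 4) ℂ} (hF : Irreducible F)
    (h : ∀ z, eval z F = 0 → eval z H = 0) : F ∣ H := by
  have hmem : H ∈ vanishingIdeal ℂ (MvPolynomial.zeroLocus ℂ (Ideal.span {F})) := by
    intro z hz
    have := hz F (Ideal.mem_span_singleton_self F)
    rw [aeval_eq_eval] at this ⊢
    exact h z this
  rw [vanishingIdeal_zeroLocus_eq_radical] at hmem
  obtain ⟨k, hk⟩ := hmem
  exact hF.prime.dvd_of_dvd_pow (Ideal.mem_span_singleton.1 hk)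

/-- An irreducible form that defines a section is linear on the fibres and vanishes identically on
none of them. -/
lemma snd_eq_one_of_isSection {F : MvPolynomial (Fin 4) ℂ} {c : ℤ × ℤ}
    (hS : IsSection d (HirzebruchSurface.zeroLocus d F)) (hirr : Irreducible F)
    (hF : IsBihomogeneous d F c) :
    c.2 = 1 ∧ ∀ q : Fin 2 → ℂ, q ≠ 0 → ∃ u v, eval ![q 0, q 1, u, v] F ≠ 0 := by
  obtain ⟨σ, hσ, hr, hrange⟩ := hS
  have huniq : ∀ (q : Fin 2 → ℂ) (hq : q ≠ 0) (u v : ℂ) (hz : InCone ![q 0, q 1, u, v]),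
      eval ![q 0, q 1, u, v] F = 0 → mk d _ hz = σ (Projectivization.mk ℂ q hq) := by
    intro q hq u v hz h0
    have hmem := (mk_mem_zeroLocus hF hz).2 h0
    rw [hrange] at hmem
    obtain ⟨p, hp⟩ := hmem
    have h1 := hr p
    rw [hp, ruling_mk] at h1
    rw [← hp, ← h1]
    congr 2
    ext i; fin_cases i <;> rfl
  have hfib : ∀ q : Fin 2 → ℂ, q ≠ 0 → ∃ u v, eval ![q 0, q 1, u, v] F ≠ 0 := by
    intro q hq
    by_contra! hall
    have hz := inCone_of_ne_zero (u := 1) (v := 0) hq (by simp)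
    have hz' := inCone_of_ne_zero (u := 0) (v := 1) hq (by simp)
    have := mul_eq_mul_of_mk_eq_mk hq hz hz'
      ((huniq q hq _ _ hz (hall _ _)).trans (huniq q hq _ _ hz' (hall _ _)).symm)
    simp at this
  have hp : (![0, 1] : Fin 2 → ℂ) ≠ 0 := fun h => by simpa using congrFun h 1
  obtain ⟨h, M, N, hh, hloc⟩ := exists_local_equation hσ hr hp
  obtain ⟨hz₀, e₀⟩ := hloc _ hp hh
  have hF₀ : eval ![0, 1, eval ![0, 1] M, eval ![0, 1] N] F = 0 := by
    have hmem : mk d _ hz₀ ∈ HirzebruchSurface.zeroLocus d F := by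
      rw [hrange, ← e₀]
      exact ⟨_, rfl⟩
    exact (mk_mem_zeroLocus hF hz₀).1 hmem
  refine ⟨?_, hfib⟩
  obtain ⟨b, hb⟩ : ∃ b : ℕ, c.2 = b := by
    obtain ⟨e, he⟩ := ne_zero_iff.1 hirr.ne_zero
    have := hF he
    rw [weight_eq, Prod.ext_iff] at this
    simp only at this
    exact ⟨e 2 + e 3, by push_cast; omega⟩
  have hF' : IsBihomogeneous d F (c.1, (b : ℤ)) := by rwa [← hb]
  -- With b = 0 the form does not involve u and v, so it vanishes on the whole fibre of a point of
  -- S.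
  have hb0 : b ≠ 0 := by
    rintro rfl
    obtain ⟨u, v, huv⟩ := hfib _ hp
    refine huv (Eq.trans ?_ hF₀)
    rw [eval_eq', eval_eq']
    refine Finset.sum_congr rfl fun e he => ?_
    have hw := hF' (mem_support_iff.1 he)
    rw [weight_eq, Prod.ext_iff] at hw
    simp only at hw
    have h2 : e 2 = 0 := by omega
    have h3 : e 3 = 0 := by omega
    simp [Fin.prod_univ_four, h2, h3]
  have hb1 : b ≤ 1 := by
    -- Locally the section is N u = M v. The factor h covers the rest of the base, and X₁ also
    -- covers points with s = t = 0, so H vanishes wherever F does. Then F ∣ H, and H has degree one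
    -- in (u, v).
    let H := ofBase (X 1 * h) * sectionForm N (-M)
    have heval : ∀ z, eval z H = z 1 * eval ![z 0, z 1] h *
        (eval ![z 0, z 1] N * z 2 - eval ![z 0, z 1] M * z 3) := by
      intro z
      simp only [H, sectionForm, map_mul, map_add, eval_ofBase, eval_X, map_neg, Matrix.cons_val]
      ring
    have hscale : ∀ z, fibreScaling z H = Polynomial.C (eval z H) * Polynomial.X := by
      intro z
      rw [heval]
      simp only [H, sectionForm, map_mul, map_add, fibreScaling_ofBase]
      simp only [fibreScaling, aeval_X, Matrix.cons_val, map_mul, map_neg, eval_X, map_sub]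
      ring
    refine le_of_dvd_fibreScaling hF' (H := H) ?_ (fun z => ?_) (fun z => ?_)
      (dvd_of_eval_eq_zero hirr fun z hz => ?_)
    · intro hH
      have h0 := fun u v => heval ![0, 1, u, v]
      simp only [hH, map_zero, Matrix.cons_val, one_mul] at h0
      refine hz₀.2 ⟨?_, ?_⟩
      · have := (mul_eq_zero.1 (h0 0 1).symm).resolve_left hh
        simpa using this
      · have := (mul_eq_zero.1 (h0 1 0).symm).resolve_left hh
        simpa using this
    · rw [hscale]
      simpa using Polynomial.natDegree_C_mul_X_pow_le (eval z H) 1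
    · simp [hscale]
    · rw [heval]
      by_cases hz1 : z 1 = 0
      · simp [hz1]
      by_cases hhz : eval ![z 0, z 1] h = 0
      · simp [hhz]
      by_cases huv : z 2 = 0 ∧ z 3 = 0
      · simp [huv.1, huv.2]
      have hq : (![z 0, z 1] : Fin 2 → ℂ) ≠ 0 := fun h => hz1 (congrFun h 1)
      have hz' := inCone_of_ne_zero hq huv
      have hz4 : ![![z 0, z 1] 0, ![z 0, z 1] 1, z 2, z 3] = z := by
        ext i; fin_cases i <;> rfl
      obtain ⟨hz'', e⟩ := hloc _ hq hhz
      have := mul_eq_mul_of_mk_eq_mk hq hz' hz''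
        ((huniq _ hq _ _ hz' (by rw [hz4]; exact hz)).trans e)
      rw [← this]
      ring
  rw [hb]
  exact_mod_cast (by omega : b = 1)

end HirzebruchSurface

/-! ### Reduction of the theorem to the form A u + B v -/

theorem mainTheorem6 (n d : ℕ) (V : Set (HirzebruchSurface d))
    (hV : HirzebruchSurface.IsDanilovGizatullin n d V) :
    derksenInvariant (HirzebruchSurface.coordinateRing d V) = ⊤ ∧
      Nonempty (makarLimanovInvariant (HirzebruchSurface.coordinateRing d V) ≃ₐ[ℂ] ℂ) := by
  obtain ⟨S, ⟨a, b⟩, hS, ⟨F, hirr, hF, rfl⟩, ⟨k, hk, hample⟩, -, rfl⟩ := hV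
  obtain ⟨hb, hfib⟩ := snd_eq_one_of_isSection hS hirr hF
  simp only at hb
  subst hb
  have ha : 0 < a := by
    rw [Prod.smul_mk] at hample
    have := pos_of_isVeryAmple hample
    rw [nsmul_eq_mul] at this
    exact pos_of_mul_pos_right this (by positivity)
  obtain ⟨m, rfl⟩ : ∃ m : ℕ, a = (m + 1 : ℕ) := ⟨(a - 1).toNat, by omega⟩
  obtain ⟨A, B, hA, hB, rfl⟩ := exists_eq_sectionForm hF
  rw [add_right_comm] at hB
  have hAB : ∀ q : Fin 2 → ℂ, q ≠ 0 → eval q A = 0 → eval q B ≠ 0 := by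
    intro q hq hAq hBq
    obtain ⟨u, v, huv⟩ := hfib q hq
    refine huv ?_
    have hq2 : ![q 0, q 1] = q := by ext i; fin_cases i <;> rfl
    simp [sectionForm, eval_ofBase, hq2, hAq, hBq]
  -- Otherwise F = B v would be reducible: B has positive degree, so it is not a unit, and neither
  -- is v.
  have hA0 : A ≠ 0 := by
    rintro rfl
    rw [sectionForm, map_zero, zero_mul, zero_add] at hirr
    rcases hirr.isUnit_or_isUnit rfl with hu | hu
    · have h0 := (hu.map (eval ![0, 0, 0, 1])).ne_zero
      refine (inCone_of_eval_sectionForm_ne_zero (z := ![0, 0, 0, 1]) hA hB ?_).1 (by simp)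
      simpa [sectionForm] using h0
    · have h0 := (hu.map (eval (0 : Fin 4 → ℂ))).ne_zero
      simp at h0
  refine ⟨derksenInvariant_compl_sectionForm hA hB hA0 hirr.prime hAB, ?_⟩
  rw [makarLimanovInvariant_compl_sectionForm hA hB hA0 hirr.prime hAB]
  -- Identifying the bottom subalgebra with ℂ requires that the ring be nonzero; 0 = 1 would
  -- identify the numerators 0 and 1 in pole order zero.
  have : Nontrivial (coordinateRing d (HirzebruchSurface.zeroLocus d (sectionForm A B))ᶜ) := by
    refine ⟨0, 1, fun h01 => zero_ne_one (α := MvPolynomial (Fin 4) ℂ) ?_⟩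
    have h0 := IsFraction.algebraMap (d := d) (F := sectionForm A B)
      (c := (((m + 1 : ℕ) : ℤ), (1 : ℤ))) 0
    have h1 := IsFraction.algebraMap (d := d) (F := sectionForm A B)
      (c := (((m + 1 : ℕ) : ℤ), (1 : ℤ))) 1
    rw [map_zero, h01, C_0] at h0
    rw [map_one, C_1] at h1
    exact h0.eq_of_eq hirr.ne_zero
      (fun z hz => inCone_of_eval_sectionForm_ne_zero hA hB hz) hF h1
  exact ⟨Algebra.botEquiv ℂ _⟩
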